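/- Let $J=\mathrm{diag}(J_x,J_y,J_z)$ with $J_x,J_y,J_z>0$ and $J_y$ strictly between $J_x$ and $J_z$. The Euler top is the system $\dot L=L\times\Omega$, $\Omega=J^{-1}L$, in $\mathbb R^3$ with energy $H=\tfrac12 L\cdot J^{-1}L$. Let $l>0$, let $E$ lie strictly between $l^2/(2J_y)$ and $l^2/(2J_z)$, and consider the motions with $|L|=l$, $H=E$ (they run around the positive or negative $z$-axis of the sphere $|L|=l$). Put $\sigma=+1$ if $J_z<J_y<J_x$ and $\sigma=-1$ if $J_x<J_y<J_z$. Let $S=S(E,l)$ be the solid angle between the equator $L_z=0$ and the orbit with $L_z>0$, counted with the sign $\sigma$. Put $$\mu=\sqrt{\Big(\tfrac{J_y}{J_x}-1\Big)\Big(1-\tfrac{J_y}{J_z}\Big)},\quad \rho=\sqrt{\Big(\tfrac{J_y}{J_x}-1\Big)\Big/\Big(1-\tfrac{J_y}{J_z}\Big)},\quad h=\frac{\sigma}{2\mu}\Big(\frac{2EJ_y}{l^2}-1\Big),$$ $$g=\Big(1+\frac{2h}{\rho}\Big)^{-1/2},\qquad m=\frac{\rho(1-2h\rho)}{2h+\rho},\qquad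 K(m)=\int_0^{\pi/2}\frac{d\theta}{\sqrt{1-m\sin^2\theta}}.$$ Then: 1. Every such motion $L(t)$ is periodic with least period $$T=\frac{4J_y\,g}{\mu\,l}K(m),$$ and its action is $\frac1{2\pi}\oint L_z\,d\psi=\frac{lS}{2\pi}$, where $\psi$, given by $(L_x,L_y)=\sqrt{L_x^2+L_y^2}\,(\sin\psi,\cos\psi)$, is the twist angle canonically conjugate to $L_z$, and the integral is taken over one period. 2. The action is differentiable in $E$, and $\dfrac{\partial}{\partial E}\dfrac{lS}{2\pi}=\dfrac{T}{2\pi}$. 3. The action is differentiable in $l$, and $\dfrac{\partial}{\partial l}\dfrac{lS}{2\pi}=-W$, where $$-2\pi W=S-\frac{2ET}{l}$$ and $W$ is the rotation number: if $R(t)\in SO(3)$ is an attitude of the body, i.e. $R^t\dot R\,v=\Omega\times v$ for all $v$ and $p=RL$ is the angular momentum fixed in space, and $\phi(t)$ is a continuous angle of rotation about $p$ (the azimuth about $p$, not reduced modulo $2\pi$, of the body $z$-axis $R\,e_z$), then $\phi(t+T)-\phi(t)=2\pi W$ for all $t$. -/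

import Mathlib

open Real MeasureTheory
open scoped Matrix

/-- Vectors with components `(x, y, z)`. -/
abbrev Vec3 : Type := Fin 3 → ℝ

/-- Angular velocity `Ω = J⁻¹ L` of a rigid body with `J = diag (J 0, J 1, J 2)`. -/
noncomputable def angVel (J L : Vec3) : Vec3 := fun i => L i / J i

/-- The Hamiltonian `H(L) = ½ L · J⁻¹ L`. -/
noncomputable def energy (J L : Vec3) : ℝ := (L ⬝ᵥ angVel J L) / 2

/-- `L` solves the Euler equations `L' = L × Ω` for all times. -/
def IsEulerSolution (J : Vec3) (L : ℝ → Vec3) : Prop :=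
  ∀ t, HasDerivAt L (L t ⨯₃ angVel J (L t)) t

/-- `R` is an attitude (body frame to space frame) belonging to the body angular momentum `L`,
with space-fixed angular momentum `p = R L`. -/
structure IsAttitude (J : Vec3) (L : ℝ → Vec3) (R : ℝ → Matrix (Fin 3) (Fin 3) ℝ)
    (p : Vec3) : Prop where
  rotation : ∀ t, R t ∈ Matrix.specialOrthogonalGroup (Fin 3) ℝ
  momentum : ∀ t, R t *ᵥ L t = p
  kinematic : ∀ (v : Vec3) (t : ℝ),
    HasDerivAt (fun s => R s *ᵥ v) (R t *ᵥ (angVel J (L t) ⨯₃ v)) t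

/-- `φ` is a continuous (not reduced mod `2π`) angle of rotation about the space-fixed vector `p`:
the azimuth, in the oriented plane orthogonal to `p`, of the body `z`-axis `R e_z`. -/
def IsSomersaultAngle (R : ℝ → Matrix (Fin 3) (Fin 3) ℝ) (p : Vec3) (φ : ℝ → ℝ) : Prop :=
  Continuous φ ∧ ∃ u v : Vec3, u ⬝ᵥ u = 1 ∧ v ⬝ᵥ v = 1 ∧ u ⬝ᵥ v = 0 ∧
    (∃ c : ℝ, 0 < c ∧ p = c • (u ⨯₃ v)) ∧
    ∀ t, ∃ r d : ℝ, 0 < r ∧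
      R t *ᵥ ![0, 0, 1] = (r * cos (φ t)) • u + (r * sin (φ t)) • v + d • p

/-- `ψ` is a continuous twist angle of `L`, with `(L_x, L_y) = r (sin ψ, cos ψ)`, `r > 0`.
For the bracket `{f, g} = ∇f · (L × ∇g)` one has `{ψ, L_z} = 1`, so that `(ψ, L_z)` are canonical
coordinates (position, momentum) on the spheres `|L| = l`. -/
def IsTwistAngle (L : ℝ → Vec3) (ψ : ℝ → ℝ) : Prop :=
  Continuous ψ ∧ ∀ t, ∃ r : ℝ, 0 < r ∧ L t 0 = r * sin (ψ t) ∧ L t 1 = r * cos (ψ t)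

/-- The action `(1/2π) ∮ L_z dψ` over the time interval `[0, T]`. -/
noncomputable def actionIntegral (L : ℝ → Vec3) (ψ : ℝ → ℝ) (T : ℝ) : ℝ :=
  (∫ t in (0 : ℝ)..T, L t 2 * deriv ψ t) / (2 * π)

/-- `T` is the least positive period of `L`. -/
def IsMinimalPeriod (L : ℝ → Vec3) (T : ℝ) : Prop :=
  IsLeast {τ : ℝ | 0 < τ ∧ Function.Periodic L τ} T

/-- The sign `σ`: `+1` if `J_z < J_y` and `-1` if `J_z > J_y`. -/
noncomputable def topSign (J : Vec3) : ℝ := Real.sign (J 1 - J 2)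

/-- The directions `u` in the unit sphere such that `l u` lies in the upper half of the sphere
`|L| = l`, between the equator `L_z = 0` and the curve `H = E` around the positive `z`-axis. -/
def equatorialRegion (J : Vec3) (E l : ℝ) :
    Set (Metric.sphere (0 : EuclideanSpace ℝ (Fin 3)) 1) :=
  {u | 0 ≤ (u : EuclideanSpace ℝ (Fin 3)) 2 ∧
    topSign J * (energy J (fun i => l * (u : EuclideanSpace ℝ (Fin 3)) i) - E) ≤ 0}

/-- The (signed) solid angle between the equator and the orbit; `Measure.toSphere volume` is the
usual surface measure of the unit sphere, of total mass `4π`. -/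
noncomputable def solidAngle (J : Vec3) (E l : ℝ) : ℝ :=
  topSign J * (volume : Measure (EuclideanSpace ℝ (Fin 3))).toSphere.real (equatorialRegion J E l)

/-- Complete elliptic integral of the first kind, as a function of the parameter `m = k²`. -/
noncomputable def ellipticK (m : ℝ) : ℝ :=
  ∫ θ in (0 : ℝ)..(π / 2), 1 / √(1 - m * sin θ ^ 2)

noncomputable def topMu (J : Vec3) : ℝ := √((J 1 / J 0 - 1) * (1 - J 1 / J 2))

noncomputable def topRho (J : Vec3) : ℝ := √((J 1 / J 0 - 1) / (1 - J 1 / J 2))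

noncomputable def topH (J : Vec3) (E l : ℝ) : ℝ :=
  topSign J * (2 * E * J 1 / l ^ 2 - 1) / (2 * topMu J)

noncomputable def topG (J : Vec3) (E l : ℝ) : ℝ := 1 / √(1 + 2 * topH J E l / topRho J)

noncomputable def topM (J : Vec3) (E l : ℝ) : ℝ :=
  topRho J * (1 - 2 * topH J E l * topRho J) / (2 * topH J E l + topRho J)

/-- The period `4 J_y g K(m) / (μ l)`. -/
noncomputable def topPeriod (J : Vec3) (E l : ℝ) : ℝ :=
  4 * J 1 * topG J E l * ellipticK (topM J E l) / (topMu J * l)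

/-! Everything reduces to integrals over one turn of the twist angle `ψ`. Eliminating `L_z` from
`|L|² = l²` and `2H = 2E` gives `A L_x² + B L_y² = D`, where the sign `σ` makes `A`, `B`, `D`
positive in both orderings of the moments of inertia. With `q(ψ) = A sin² ψ + B cos² ψ`, the orbit
is `L_x² + L_y² = D/q`, `|L_z| = z(ψ) = √(l² - D/q)`, and Euler's equations become `ψ' = ± q z`, an
autonomous flow on the circle without rest points (`twistAngle_flow`).

Hence `T = ∮ dψ/(q z)`, which the substitution `tan θ = τ tan x` turns into the complete elliptic
integral (`integral_period_eq_ellipticK`). The action is `σ ∮ z dψ / 2π`. By Archimedes, a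
unit-sphere strip of width `dψ` from the equator up to height `c` has area `c dψ`, so the same
integral is `l S` (`toSphere_real_cone`, `solidAngle_eq`).

Differentiation under the integral sign gives the rest. Since `∂D/∂E = -2σ`, the `E`-derivative of
`σ z` is `1/(q z)`, which integrates to `T`. The `l`-derivative of `σ ∮ z dψ` is `σ l ∮ dψ/z - l
T/J_z`. The kinematic equation gives `φ' = l/J_z - σ l q(ψ)`, whose integral over a period is the
negative of that expression, and `z = l²/z - D/(q z)` rewrites it as `S - 2ET/l`
(`integral_twistSpeed_eq`). -/

/-! ### Polar angles of plane curves -/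

/-- A continuous polar angle of a differentiable plane curve is differentiable. -/
theorem hasDerivAt_polarAngle {X Y ψ : ℝ → ℝ} {X' Y' t : ℝ} (hX : HasDerivAt X X' t)
    (hY : HasDerivAt Y Y' t) (hψ : ContinuousAt ψ t)
    (h : ∀ s, ∃ r : ℝ, 0 < r ∧ X s = r * cos (ψ s) ∧ Y s = r * sin (ψ s)) :
    HasDerivAt ψ ((X t * Y' - Y t * X') / (X t ^ 2 + Y t ^ 2)) t := by
  have hpos : 0 < X t * X t + Y t * Y t := by
    obtain ⟨r, hr, h1, h2⟩ := h t
    have : X t * X t + Y t * Y t = r ^ 2 := by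
      rw [h1, h2]; linear_combination r ^ 2 * sin_sq_add_cos_sq (ψ t)
    rw [this]; positivity
  -- Cross and dot products with the fixed vector at time `t`: their quotient is `tan (ψ s - ψ t)`,
  -- so near `t` the angle is `ψ t` plus a smooth arctangent.
  have hN : HasDerivAt (fun s => X t * Y s - Y t * X s) (X t * Y' - Y t * X') t :=
    (hY.const_mul _).sub (hX.const_mul _)
  have hM : HasDerivAt (fun s => X t * X s + Y t * Y s) (X t * X' + Y t * Y') t :=
    (hX.const_mul _).add (hY.const_mul _)
  have hA := ((hN.div hM hpos.ne').arctan).const_add (ψ t)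
  have hval : (X t * Y' - Y t * X') / (X t ^ 2 + Y t ^ 2) =
      1 / (1 + ((X t * Y t - Y t * X t) / (X t * X t + Y t * Y t)) ^ 2) *
        (((X t * Y' - Y t * X') * (X t * X t + Y t * Y t) -
          (X t * Y t - Y t * X t) * (X t * X' + Y t * Y')) / (X t * X t + Y t * Y t) ^ 2) := by
    have h0 : X t * Y t - Y t * X t = 0 := by ring
    have h1 : X t ^ 2 + Y t ^ 2 = X t * X t + Y t * Y t := by ring
    rw [h0, h1]
    generalize X t * X t + Y t * Y t = S at hpos
    have := hpos.ne'
    field_simp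
    ring
  rw [hval]
  refine hA.congr_of_eventuallyEq ?_
  -- Continuity of `ψ` keeps the increment on the principal branch of the arctangent.
  have hev : ∀ᶠ s in nhds t, ψ s - ψ t ∈ Set.Ioo (-(π / 2)) (π / 2) := by
    have : ContinuousAt (fun s => ψ s - ψ t) t := hψ.sub continuousAt_const
    refine this.eventually_mem (Ioo_mem_nhds ?_ ?_) <;> simp [pi_pos]
  filter_upwards [hev] with s hs
  obtain ⟨r, hr, h1, h2⟩ := h t
  obtain ⟨r', hr', h1', h2'⟩ := h s
  have : (X t * Y s - Y t * X s) / (X t * X s + Y t * Y s) = tan (ψ s - ψ t) := by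
    rw [tan_eq_sin_div_cos, sin_sub, cos_sub, h1, h2, h1', h2']
    rw [show r * cos (ψ t) * (r' * sin (ψ s)) - r * sin (ψ t) * (r' * cos (ψ s)) =
      (r * r') * (sin (ψ s) * cos (ψ t) - cos (ψ s) * sin (ψ t)) by ring,
      show r * cos (ψ t) * (r' * cos (ψ s)) + r * sin (ψ t) * (r' * sin (ψ s)) =
      (r * r') * (cos (ψ s) * cos (ψ t) + sin (ψ s) * sin (ψ t)) by ring]
    exact mul_div_mul_left _ _ (by positivity)
  simp only [Pi.div_apply]
  rw [this, arctan_tan hs.1 hs.2]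
  ring

/-- A `C¹` plane curve that avoids the origin has a continuous polar angle. -/
theorem exists_polarAngle {X Y X' Y' : ℝ → ℝ} (hX : ∀ t, HasDerivAt X (X' t) t)
    (hY : ∀ t, HasDerivAt Y (Y' t) t) (hX' : Continuous X') (hY' : Continuous Y')
    (hne : ∀ t, X t ^ 2 + Y t ^ 2 ≠ 0) :
    ∃ ψ : ℝ → ℝ, Continuous ψ ∧
      ∀ s, ∃ r : ℝ, 0 < r ∧ X s = r * cos (ψ s) ∧ Y s = r * sin (ψ s) := by
  set w : ℝ → ℂ := fun t => X t + Y t * Complex.I with hw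
  set w' : ℝ → ℂ := fun t => X' t + Y' t * Complex.I with hw'
  have hwd : ∀ t, HasDerivAt w (w' t) t := fun t =>
    (hX t).ofReal_comp.add ((hY t).ofReal_comp.mul_const _)
  have hXc : Continuous X := continuous_iff_continuousAt.2 fun t => (hX t).continuousAt
  have hYc : Continuous Y := continuous_iff_continuousAt.2 fun t => (hY t).continuousAt
  have hwc : Continuous w := by fun_prop
  have hwc' : Continuous w' := by fun_prop
  have hw0 : ∀ t, w t ≠ 0 := by
    intro t h0
    apply hne t
    have h1 : X t = 0 := by simpa [hw] using congrArg Complex.re h0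
    have h2 : Y t = 0 := by simpa [hw] using congrArg Complex.im h0
    simp [h1, h2]
  have hqc : Continuous fun t => w' t / w t := hwc'.div hwc hw0
  -- A global logarithm of the curve, obtained by integrating `w'/w`; its imaginary part is the
  -- angle.
  set Θ : ℝ → ℂ := fun t => Complex.log (w 0) + ∫ s in (0 : ℝ)..t, w' s / w s with hΘ
  have hΘd : ∀ t, HasDerivAt Θ (w' t / w t) t := fun t =>
    (intervalIntegral.integral_hasDerivAt_right (hqc.intervalIntegrable _ _)
      hqc.aestronglyMeasurable.stronglyMeasurableAtFilter hqc.continuousAt).const_add _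
  have hconst : ∀ t, w t * Complex.exp (-Θ t) = 1 := by
    have hd : ∀ t, HasDerivAt (fun t => w t * Complex.exp (-Θ t)) 0 t := by
      intro t
      refine ((hwd t).mul ((hΘd t).neg.cexp)).congr_deriv ?_
      have := hw0 t
      field_simp
      ring
    intro t
    have h1 := is_const_of_deriv_eq_zero (fun t => (hd t).differentiableAt)
      (fun t => (hd t).deriv) t 0
    rw [h1]
    simp only [hΘ, intervalIntegral.integral_same, add_zero, Complex.exp_neg]
    rw [Complex.exp_log (hw0 0), mul_inv_cancel₀ (hw0 0)]
  have hexp : ∀ t, w t = Complex.exp (Θ t) := by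
    intro t
    have := hconst t
    rw [Complex.exp_neg] at this
    field_simp [Complex.exp_ne_zero] at this
    exact this
  refine ⟨fun t => (Θ t).im, Complex.continuous_im.comp
    (continuous_iff_continuousAt.2 fun t => (hΘd t).continuousAt), fun s =>
    ⟨Real.exp (Θ s).re, Real.exp_pos _, ?_, ?_⟩⟩
  · have := congrArg Complex.re (hexp s)
    simpa [hw, Complex.exp_re] using this
  · have := congrArg Complex.im (hexp s)
    simpa [hw, Complex.exp_im] using this

/-! ### Periodic integrands and flows on the circle -/

theorem integral_add_int_mul_two_pi {f : ℝ → ℝ} (hf : Continuous f)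
    (hp : Function.Periodic f (2 * π)) (x : ℝ) (n : ℤ) :
    ∫ s in (0 : ℝ)..(x + n * (2 * π)), f s =
      (∫ s in (0 : ℝ)..x, f s) + n * ∫ s in (0 : ℝ)..(2 * π), f s := by
  rw [← intervalIntegral.integral_add_adjacent_intervals (hf.intervalIntegrable 0 x)
    (hf.intervalIntegrable x _)]
  have h := hp.intervalIntegral_add_zsmul_eq n x (fun a b => hf.intervalIntegrable a b)
  simp only [zsmul_eq_mul] at h
  rw [h, hp.intervalIntegral_add_eq x 0, zero_add]

theorem hasDerivAt_integral_comp {f ψ : ℝ → ℝ} {ψ' t : ℝ} (hf : Continuous f)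
    (hψ : HasDerivAt ψ ψ' t) :
    HasDerivAt (fun t => ∫ s in (0 : ℝ)..ψ t, f s) (f (ψ t) * ψ') t :=
  HasDerivAt.comp t (intervalIntegral.integral_hasDerivAt_right (hf.intervalIntegrable _ _)
      hf.aestronglyMeasurable.stronglyMeasurableAtFilter hf.continuousAt) hψ

/-- If `N' = f(ψ) ψ'`, then the increments of `N` are those of a primitive of `f` along `ψ`. -/
theorem integral_comp_flow {f g ψ N N' : ℝ → ℝ} (hf : Continuous f)
    (hψ : ∀ t, HasDerivAt ψ (g t) t) (hN : ∀ t, HasDerivAt N (N' t) t)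
    (h : ∀ t, N' t = f (ψ t) * g t) (t s : ℝ) :
    N t - N s = (∫ x in (0 : ℝ)..ψ t, f x) - ∫ x in (0 : ℝ)..ψ s, f x := by
  have hd : ∀ t, HasDerivAt (fun t => N t - ∫ x in (0 : ℝ)..ψ t, f x) 0 t := fun t =>
    ((hN t).sub (hasDerivAt_integral_comp hf (hψ t))).congr_deriv (by rw [h t, sub_self])
  have := is_const_of_deriv_eq_zero (fun t => (hd t).differentiableAt) (fun t => (hd t).deriv) t s
  linarith

section Flow

variable {G ψ : ℝ → ℝ} {κ : ℝ}

/-- For a motion `ψ' = κ G(ψ)` on the circle, an advance by `n` turns takes `n` periods. -/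
theorem flow_time_eq (hG : Continuous G) (hpos : ∀ x, 0 < G x)
    (hper : Function.Periodic G (2 * π)) (hψ : ∀ t, HasDerivAt ψ (κ * G (ψ t)) t)
    {t τ : ℝ} {n : ℤ} (h : ψ (t + τ) = ψ t + n * (2 * π)) :
    κ * τ = n * ∫ x in (0 : ℝ)..(2 * π), 1 / G x := by
  have hc : Continuous fun x => 1 / G x := continuous_const.div hG fun x => (hpos x).ne'
  have hp : Function.Periodic (fun x => 1 / G x) (2 * π) := fun x => by simp only [hper x]
  have h1 := integral_comp_flow (N := fun t => κ * t) (N' := fun _ => κ) hc hψ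
    (fun t => by simpa using (hasDerivAt_id t).const_mul κ)
    (fun t => by have := (hpos (ψ t)).ne'; field_simp) (t + τ) t
  rw [h, integral_add_int_mul_two_pi hc hp] at h1
  linarith

/-- The primitive of `1/G` along `ψ` grows at the constant rate `κ`. After time `T` it has grown by
`n T`, exactly what `n` turns contribute, and it is strictly increasing in the angle, so the angle
has advanced by `n` turns. A negative `n` covers motions in which the angle decreases. -/
theorem flow_add_period (hG : Continuous G) (hpos : ∀ x, 0 < G x)
    (hper : Function.Periodic G (2 * π)) (hψ : ∀ t, HasDerivAt ψ (κ * G (ψ t)) t)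
    {n : ℤ} (hκ : κ = n) (t : ℝ) :
    ψ (t + ∫ x in (0 : ℝ)..(2 * π), 1 / G x) = ψ t + n * (2 * π) := by
  have hc : Continuous fun x => 1 / G x := continuous_const.div hG fun x => (hpos x).ne'
  have hp : Function.Periodic (fun x => 1 / G x) (2 * π) := fun x => by simp only [hper x]
  set T := ∫ x in (0 : ℝ)..(2 * π), 1 / G x with hT
  have h1 := integral_comp_flow (N := fun t => κ * t) (N' := fun _ => κ) hc hψ
    (fun t => by simpa using (hasDerivAt_id t).const_mul κ)
    (fun t => by have := (hpos (ψ t)).ne'; field_simp) (t + T) t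
  have h2 := integral_add_int_mul_two_pi hc hp (ψ t) n
  rw [← hT] at h2
  have h3 : (∫ x in (0 : ℝ)..ψ (t + T), 1 / G x) =
      ∫ x in (0 : ℝ)..(ψ t + n * (2 * π)), 1 / G x := by
    rw [h2, ← hκ]; linarith
  have hmono : StrictMono fun y => ∫ x in (0 : ℝ)..y, 1 / G x := by
    refine strictMono_of_hasDerivAt_pos (f' := fun x => 1 / G x) (fun y => ?_)
      fun x => one_div_pos.2 (hpos x)
    simpa using hasDerivAt_integral_comp hc (hasDerivAt_id y)
  exact hmono.injective h3

end Flow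

/-! ### Spherical coordinates and the volume over a strip of longitude -/

section SphericalCoordinates

open scoped ENNReal

theorem measurable_vec3 : Measurable fun q : ℝ × ℝ × ℝ =>
    (WithLp.toLp 2 ![q.1, q.2.1, q.2.2] : EuclideanSpace ℝ (Fin 3)) := by
  refine (WithLp.measurable_toLp 2 _).comp (measurable_pi_lambda _ fun i => ?_)
  fin_cases i
  · exact measurable_fst
  · exact measurable_fst.comp measurable_snd
  · exact measurable_snd.comp measurable_snd

theorem lintegral_euclideanSpace_three {f : EuclideanSpace ℝ (Fin 3) → ℝ≥0∞} (hf : Measurable f) :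
    ∫⁻ x, f x = ∫⁻ z : ℝ, ∫⁻ p : ℝ × ℝ, f (WithLp.toLp 2 ![p.1, p.2, z]) := by
  have hf' : Measurable fun q : ℝ × ℝ × ℝ => f (WithLp.toLp 2 ![q.1, q.2.1, q.2.2]) :=
    hf.comp measurable_vec3
  rw [← (PiLp.volume_preserving_toLp (Fin 3)).lintegral_comp hf,
    ← ((volume_preserving_piFinSuccAbove (fun _ : Fin 3 => ℝ) 2).symm).lintegral_comp_emb
      (MeasurableEquiv.measurableEmbedding _), Measure.volume_eq_prod, lintegral_prod]
  · refine lintegral_congr fun z => ?_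
    rw [← ((volume_preserving_finTwoArrow ℝ).symm).lintegral_comp_emb
      (MeasurableEquiv.measurableEmbedding _)]
    refine lintegral_congr fun p => ?_
    congr 2
    ext i
    fin_cases i <;> rfl
  · exact (hf.comp ((WithLp.measurable_toLp 2 _).comp
      (MeasurableEquiv.measurable _))).aemeasurable

theorem setLIntegral_polarCoord_target {g : ℝ × ℝ → ℝ≥0∞} (hg : Measurable g) :
    ∫⁻ p in polarCoord.target, g p =
      ∫⁻ ψ in Set.Ioo (-π) π, ∫⁻ r in Set.Ioi (0 : ℝ), g (r, ψ) := by
  rw [polarCoord_target, Measure.volume_eq_prod, ← Measure.prod_restrict,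
    lintegral_prod_symm _ hg.aemeasurable]

/-- Spherical coordinates with longitude `ψ` and latitude `β`. -/
theorem lintegral_sphericalCoord {f : EuclideanSpace ℝ (Fin 3) → ℝ≥0∞} (hf : Measurable f) :
    ∫⁻ x, f x = ∫⁻ ψ in Set.Ioo (-π) π, ∫⁻ β in Set.Ioo (-π) π, ∫⁻ s in Set.Ioi (0 : ℝ),
      ENNReal.ofReal s * (Set.Ioi (0 : ℝ)).indicator (fun r => ENNReal.ofReal r *
        f (WithLp.toLp 2 ![r * cos ψ, r * sin ψ, s * sin β])) (s * cos β) := by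
  have hm : Measurable fun q : ℝ × ℝ × ℝ =>
      ENNReal.ofReal q.1 * f (WithLp.toLp 2 ![q.1 * cos q.2.1, q.1 * sin q.2.1, q.2.2]) := by
    refine (ENNReal.measurable_ofReal.comp measurable_fst).mul (hf.comp ?_)
    have : Measurable fun q : ℝ × ℝ × ℝ => (q.1 * cos q.2.1, q.1 * sin q.2.1, q.2.2) := by
      fun_prop
    exact measurable_vec3.comp this
  rw [lintegral_euclideanSpace_three hf]
  -- Polar coordinates are used twice: first in the `(x, y)` plane, then in the half plane `(r, z)`.
  have h1 : ∀ z : ℝ, ∫⁻ p : ℝ × ℝ, f (WithLp.toLp 2 ![p.1, p.2, z]) =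
      ∫⁻ ψ in Set.Ioo (-π) π, ∫⁻ r in Set.Ioi (0 : ℝ),
        ENNReal.ofReal r * f (WithLp.toLp 2 ![r * cos ψ, r * sin ψ, z]) := by
    intro z
    rw [← lintegral_comp_polarCoord_symm]
    have : Measurable fun p : ℝ × ℝ =>
        ENNReal.ofReal p.1 * f (WithLp.toLp 2 ![p.1 * cos p.2, p.1 * sin p.2, z]) := by
      have h2 : Measurable fun p : ℝ × ℝ => (p.1, p.2, z) := by fun_prop
      exact hm.comp h2
    rw [← setLIntegral_polarCoord_target this]
    simp [polarCoord_symm_apply]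
  simp only [h1]
  rw [lintegral_lintegral_swap]
  · refine lintegral_congr fun ψ => ?_
    -- The indicator of `r > 0` extends the half plane `(r, z)` to the full plane, so that polar
    -- coordinates apply to it; it survives as the condition `0 < s cos β`.
    have hmψ : Measurable fun p : ℝ × ℝ =>
        (Set.Ioi (0 : ℝ)).indicator (fun r => ENNReal.ofReal r *
          f (WithLp.toLp 2 ![r * cos ψ, r * sin ψ, p.2])) p.1 := by
      have h2 : Measurable fun p : ℝ × ℝ => (p.1, ψ, p.2) := by fun_prop
      exact (hm.comp h2).indicator (measurable_fst measurableSet_Ioi)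
    have h3 : ∫⁻ z : ℝ, ∫⁻ r in Set.Ioi (0 : ℝ),
        ENNReal.ofReal r * f (WithLp.toLp 2 ![r * cos ψ, r * sin ψ, z]) =
        ∫⁻ p : ℝ × ℝ, (Set.Ioi (0 : ℝ)).indicator (fun r => ENNReal.ofReal r *
          f (WithLp.toLp 2 ![r * cos ψ, r * sin ψ, p.2])) p.1 := by
      rw [Measure.volume_eq_prod, lintegral_prod_symm _ hmψ.aemeasurable]
      refine lintegral_congr fun z => ?_
      rw [← lintegral_indicator measurableSet_Ioi]
    have h4 := (ENNReal.measurable_ofReal.comp measurable_fst).mul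
      (hmψ.comp continuous_polarCoord_symm.measurable)
    rw [h3, ← lintegral_comp_polarCoord_symm]
    refine (setLIntegral_polarCoord_target h4).trans ?_
    simp [polarCoord_symm_apply]
  · have h5 : Measurable fun q : (ℝ × ℝ) × ℝ => ENNReal.ofReal q.2 *
        f (WithLp.toLp 2 ![q.2 * cos q.1.2, q.2 * sin q.1.2, q.1.1]) := by
      have h2 : Measurable fun q : (ℝ × ℝ) × ℝ => (q.2, q.1.2, q.1.1) := by fun_prop
      exact hm.comp h2
    exact h5.lintegral_prod_right'.aemeasurable

/-- The volume of the part of the unit ball over a longitude `ψ`, between the equator and the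
latitude with sine `c`. -/
theorem lintegral_latitude {S : Set (ℝ × ℝ)} {c : ℝ} (hc0 : 0 ≤ c) (hc1 : c < 1)
    (hS : ∀ s β : ℝ, 0 < s → 0 < cos β →
      ((s, β) ∈ S ↔ s < 1 ∧ 0 ≤ sin β ∧ sin β ^ 2 ≤ c ^ 2)) :
    ∫⁻ β in Set.Ioo (-π) π, ∫⁻ s in Set.Ioi (0 : ℝ),
      ENNReal.ofReal s * (Set.Ioi (0 : ℝ)).indicator (fun r => ENNReal.ofReal r *
        S.indicator 1 (s, β)) (s * cos β) = ENNReal.ofReal (c / 3) := by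
  have hβ0 : 0 ≤ arcsin c := arcsin_nonneg.2 hc0
  have hβ1 : arcsin c < π / 2 := arcsin_lt_pi_div_two.2 hc1
  have hpi := pi_pos
  have hmem : ∀ β ∈ Set.Ioo (-π) π,
      (0 < cos β ∧ 0 ≤ sin β ∧ sin β ^ 2 ≤ c ^ 2 ↔ β ∈ Set.Icc 0 (arcsin c)) := by
    intro β hβ
    constructor
    · rintro ⟨h1, h2, h3⟩
      have hb0 : 0 ≤ β := by
        by_contra hneg
        exact absurd h2 (not_le.2 (sin_neg_of_neg_of_neg_pi_lt (not_le.1 hneg) hβ.1))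
      have hb1 : β ≤ π / 2 := by
        by_contra hgt
        have := cos_neg_of_pi_div_two_lt_of_lt (not_le.1 hgt) (by linarith [hβ.2])
        linarith
      refine ⟨hb0, (le_arcsin_iff_sin_le ⟨by linarith, hb1⟩ ⟨by linarith, hc1.le⟩).2 ?_⟩
      exact (pow_le_pow_iff_left₀ h2 hc0 two_ne_zero).1 h3
    · rintro ⟨h1, h2⟩
      have h3 : 0 ≤ sin β := sin_nonneg_of_nonneg_of_le_pi h1 hβ.2.le
      refine ⟨cos_pos_of_mem_Ioo ⟨by linarith, by linarith⟩, h3, ?_⟩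
      have := (le_arcsin_iff_sin_le ⟨by linarith, by linarith⟩ ⟨by linarith, hc1.le⟩).1 h2
      gcongr
  -- The Jacobian `s · s cos β`, integrated over `0 < s < 1`, leaves `cos β / 3`; its integral over
  -- the latitudes `0 ≤ β ≤ arcsin c` is then `c / 3`.
  have hin : ∀ β ∈ Set.Ioo (-π) π, ∫⁻ s in Set.Ioi (0 : ℝ),
      ENNReal.ofReal s * (Set.Ioi (0 : ℝ)).indicator (fun r => ENNReal.ofReal r *
        S.indicator 1 (s, β)) (s * cos β) =
      (Set.Icc 0 (arcsin c)).indicator (fun β => ENNReal.ofReal (cos β / 3)) β := by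
    intro β hβ
    by_cases hb : β ∈ Set.Icc 0 (arcsin c)
    · rw [Set.indicator_of_mem hb]
      obtain ⟨h1, h2, h3⟩ := (hmem β hβ).2 hb
      have : ∀ s ∈ Set.Ioi (0 : ℝ),
          ENNReal.ofReal s * (Set.Ioi (0 : ℝ)).indicator (fun r => ENNReal.ofReal r *
            S.indicator 1 (s, β)) (s * cos β) =
          (Set.Ioo (0 : ℝ) 1).indicator (fun s => ENNReal.ofReal (s ^ 2 * cos β)) s := by
        intro s hs
        have hs' : 0 < s := hs
        rw [Set.indicator_of_mem (Set.mem_Ioi.2 (mul_pos hs' h1))]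
        by_cases hs1 : s < 1
        · rw [Set.indicator_of_mem ((hS s β hs' h1).2 ⟨hs1, h2, h3⟩),
            Set.indicator_of_mem (Set.mem_Ioo.2 ⟨hs', hs1⟩), Pi.one_apply, mul_one,
            ← ENNReal.ofReal_mul hs'.le]
          congr 1
          ring
        · rw [Set.indicator_of_notMem fun h => hs1 ((hS s β hs' h1).1 h).1,
            Set.indicator_of_notMem fun h => hs1 h.2]
          simp
      rw [setLIntegral_congr_fun measurableSet_Ioi this, setLIntegral_indicator measurableSet_Ioo,
        Set.inter_eq_left.2 Set.Ioo_subset_Ioi_self, ← setLIntegral_congr Ioo_ae_eq_Ioc.symm,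
        ← ofReal_integral_eq_lintegral_ofReal, ← intervalIntegral.integral_of_le zero_le_one]
      · congr 1
        rw [intervalIntegral.integral_mul_const, integral_pow]
        norm_num
        ring
      · exact (Continuous.intervalIntegrable (by fun_prop) _ _).1
      · exact Filter.Eventually.of_forall fun s => by positivity
    · rw [Set.indicator_of_notMem hb]
      refine (setLIntegral_congr_fun measurableSet_Ioi (g := fun _ => 0) fun s hs => ?_).trans
        (by simp)
      have hs' : 0 < s := hs
      by_cases h1 : 0 < cos β
      · have : (s, β) ∉ S := fun h =>
          hb ((hmem β hβ).1 ⟨h1, ((hS s β hs' h1).1 h).2⟩)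
        simp only [Set.indicator_of_notMem this, mul_zero, Set.indicator_zero]
      · have : s * cos β ∉ Set.Ioi (0 : ℝ) := fun h => h1 (pos_of_mul_pos_right h hs'.le)
        simp only [Set.indicator_of_notMem this, mul_zero]
  rw [setLIntegral_congr_fun measurableSet_Ioo hin, setLIntegral_indicator measurableSet_Icc,
    Set.inter_eq_left.2 (show Set.Icc 0 (arcsin c) ⊆ Set.Ioo (-π) π from
      fun x hx => ⟨by linarith [hx.1], by linarith [hx.2]⟩),
    ← setLIntegral_congr Ioc_ae_eq_Icc, ← ofReal_integral_eq_lintegral_ofReal,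
    ← intervalIntegral.integral_of_le hβ0]
  · congr 1
    rw [intervalIntegral.integral_div, integral_cos, sin_arcsin (by linarith) hc1.le]
    simp
  · exact (Continuous.intervalIntegrable (by fun_prop) _ _).1
  · refine (ae_restrict_iff' measurableSet_Ioc).2 (Filter.Eventually.of_forall fun x hx => ?_)
    have := cos_nonneg_of_mem_Icc (x := x) ⟨by linarith [hx.1], by linarith [hx.2]⟩
    simp only [Pi.zero_apply]
    positivity

end SphericalCoordinates

/-! ### The area between the equator and a quadratic cone -/

/-- The quadratic form `A x² + B y²` at `(sin ψ, cos ψ)`. -/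
noncomputable def angleForm (A B ψ : ℝ) : ℝ := A * sin ψ ^ 2 + B * cos ψ ^ 2

theorem continuous_angleForm (A B : ℝ) : Continuous (angleForm A B) := by
  unfold angleForm; fun_prop

/-- The value is a mean of `A` and `B` with weights `sin² ψ` and `cos² ψ`. -/
theorem lt_angleForm {A B k : ℝ} (hA : k < A) (hB : k < B) (ψ : ℝ) : k < angleForm A B ψ := by
  have h : angleForm A B ψ - k = (A - k) * sin ψ ^ 2 + (B - k) * cos ψ ^ 2 := by
    unfold angleForm; linear_combination k * sin_sq_add_cos_sq ψ
  have h1 : 0 ≤ (A - k) * sin ψ ^ 2 := mul_nonneg (by linarith) (sq_nonneg _)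
  have h2 : 0 ≤ (B - k) * cos ψ ^ 2 := mul_nonneg (by linarith) (sq_nonneg _)
  by_contra hn
  have h3 : sin ψ ^ 2 = 0 := by
    have : (A - k) * sin ψ ^ 2 = 0 := by linarith
    exact (mul_eq_zero.1 this).resolve_left (by linarith)
  have h4 : cos ψ ^ 2 = 0 := by
    have : (B - k) * cos ψ ^ 2 = 0 := by linarith
    exact (mul_eq_zero.1 this).resolve_left (by linarith)
  linarith [sin_sq_add_cos_sq ψ]

theorem angleForm_periodic (A B : ℝ) : Function.Periodic (angleForm A B) (2 * π) := fun x => by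
  simp [angleForm]

open scoped Pointwise in
/-- The area of the part of the unit sphere between the equator and a quadratic cone. -/
theorem toSphere_real_cone {A B k : ℝ} (hk : 0 < k) (hA : k < A) (hB : k < B) :
    (volume : Measure (EuclideanSpace ℝ (Fin 3))).toSphere.real
      {u | 0 ≤ (u : EuclideanSpace ℝ (Fin 3)) 2 ∧
        k ≤ A * (u : EuclideanSpace ℝ (Fin 3)) 0 ^ 2 + B * (u : EuclideanSpace ℝ (Fin 3)) 1 ^ 2} =
      ∫ ψ in (0 : ℝ)..(2 * π), √(1 - k / angleForm A B ψ) := by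
  set s : Set (Metric.sphere (0 : EuclideanSpace ℝ (Fin 3)) 1) :=
    {u | 0 ≤ (u : EuclideanSpace ℝ (Fin 3)) 2 ∧
      k ≤ A * (u : EuclideanSpace ℝ (Fin 3)) 0 ^ 2 + B * (u : EuclideanSpace ℝ (Fin 3)) 1 ^ 2}
    with hs
  -- The cone over `s` in the open unit ball, without its apex. The surface measure of `s` is three
  -- times its volume, which cancels the `1/3` from the radial integral.
  set C : Set (EuclideanSpace ℝ (Fin 3)) := {x | 0 < ‖x‖ ∧ ‖x‖ < 1 ∧ 0 ≤ x 2 ∧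
    k * ‖x‖ ^ 2 ≤ A * x 0 ^ 2 + B * x 1 ^ 2} with hC
  have hsm : MeasurableSet s := by
    have h1 : MeasurableSet {u : Metric.sphere (0 : EuclideanSpace ℝ (Fin 3)) 1 |
        0 ≤ (u : EuclideanSpace ℝ (Fin 3)) 2} :=
      (isClosed_le (by fun_prop) (by fun_prop)).measurableSet
    have h2 : MeasurableSet {u : Metric.sphere (0 : EuclideanSpace ℝ (Fin 3)) 1 |
        k ≤ A * (u : EuclideanSpace ℝ (Fin 3)) 0 ^ 2 +
          B * (u : EuclideanSpace ℝ (Fin 3)) 1 ^ 2} :=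
      (isClosed_le (by fun_prop) (by fun_prop)).measurableSet
    exact h1.inter h2
  have hCm : MeasurableSet C := by
    have h1 : MeasurableSet {x : EuclideanSpace ℝ (Fin 3) | 0 < ‖x‖} :=
      (isOpen_lt (by fun_prop) (by fun_prop)).measurableSet
    have h2 : MeasurableSet {x : EuclideanSpace ℝ (Fin 3) | ‖x‖ < 1} :=
      (isOpen_lt (by fun_prop) (by fun_prop)).measurableSet
    have h3 : MeasurableSet {x : EuclideanSpace ℝ (Fin 3) | 0 ≤ x 2} :=
      (isClosed_le (by fun_prop) (by fun_prop)).measurableSet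
    have h4 : MeasurableSet {x : EuclideanSpace ℝ (Fin 3) |
        k * ‖x‖ ^ 2 ≤ A * x 0 ^ 2 + B * x 1 ^ 2} :=
      (isClosed_le (by fun_prop) (by fun_prop)).measurableSet
    exact h1.inter (h2.inter (h3.inter h4))
  have hcone : Set.Ioo (0 : ℝ) 1 • ((↑) '' s : Set (EuclideanSpace ℝ (Fin 3))) = C := by
    ext x
    rw [Set.mem_smul]
    constructor
    · rintro ⟨c, hc, _, ⟨u, hu, rfl⟩, rfl⟩
      have hn : ‖c • (u : EuclideanSpace ℝ (Fin 3))‖ = c := by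
        rw [norm_smul, norm_eq_of_mem_sphere, mul_one, Real.norm_of_nonneg hc.1.le]
      refine ⟨by rw [hn]; exact hc.1, by rw [hn]; exact hc.2, ?_, ?_⟩
      · exact mul_nonneg hc.1.le hu.1
      · rw [hn]
        have := mul_le_mul_of_nonneg_left hu.2 (sq_nonneg c)
        simp only [PiLp.smul_apply, smul_eq_mul]
        nlinarith
    · rintro ⟨h1, h2, h3, h4⟩
      refine ⟨‖x‖, ⟨h1, h2⟩, ‖x‖⁻¹ • x, ⟨⟨‖x‖⁻¹ • x, ?_⟩, ⟨?_, ?_⟩, rfl⟩, ?_⟩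
      · simp [norm_smul, h1.ne']
      · exact mul_nonneg (inv_nonneg.2 h1.le) h3
      · simp only [PiLp.smul_apply, smul_eq_mul]
        rw [show A * (‖x‖⁻¹ * x 0) ^ 2 + B * (‖x‖⁻¹ * x 1) ^ 2 =
          (A * x 0 ^ 2 + B * x 1 ^ 2) / ‖x‖ ^ 2 by field_simp, le_div_iff₀ (by positivity)]
        exact h4
      · rw [smul_smul, mul_inv_cancel₀ h1.ne', one_smul]
  have hper : Function.Periodic (fun ψ => √(1 - k / angleForm A B ψ)) (2 * π) := fun x => by
    simp only [angleForm_periodic A B x]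
  have hpos : ∀ ψ, 0 < angleForm A B ψ := fun ψ => hk.trans (lt_angleForm hA hB ψ)
  have hcont : Continuous fun ψ => √(1 - k / angleForm A B ψ) :=
    (continuous_const.sub (continuous_const.div (continuous_angleForm A B)
      fun ψ => (hpos ψ).ne')).sqrt
  -- The argument is `π / 2 - ψ` because the form is evaluated at `(sin, cos)`, whereas polar
  -- coordinates use `(cos, sin)`.
  have hvol : volume C = ∫⁻ ψ in Set.Ioo (-π) π,
      ENNReal.ofReal (√(1 - k / angleForm A B (π / 2 - ψ)) / 3) := by
    rw [← lintegral_indicator_one hCm, lintegral_sphericalCoord (measurable_one.indicator hCm)]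
    refine lintegral_congr fun ψ => ?_
    have hq := lt_angleForm hA hB (π / 2 - ψ)
    have hq0 := hk.trans hq
    have hle : 0 ≤ 1 - k / angleForm A B (π / 2 - ψ) := by
      rw [sub_nonneg, div_le_one hq0]; exact hq.le
    rw [← lintegral_latitude (S := {p | WithLp.toLp 2
      ![p.1 * cos p.2 * cos ψ, p.1 * cos p.2 * sin ψ, p.1 * sin p.2] ∈ C}) (sqrt_nonneg _)
      (by rw [sqrt_lt' one_pos]; have := div_pos hk hq0; linarith)]
    · rfl
    · intro s β hs0 hβ
      have hn2 : ‖(WithLp.toLp 2 ![s * cos β * cos ψ, s * cos β * sin ψ, s * sin β] :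
          EuclideanSpace ℝ (Fin 3))‖ = s := by
        rw [EuclideanSpace.norm_eq, Fin.sum_univ_three]
        simp only [Real.norm_eq_abs, sq_abs]
        rw [sqrt_eq_iff_mul_self_eq_of_pos hs0]
        simp
        linear_combination (-s ^ 2 * cos β ^ 2) * sin_sq_add_cos_sq ψ -
          s ^ 2 * sin_sq_add_cos_sq β
      simp only [hC, Set.mem_ofPred_eq, hn2]
      rw [sq_sqrt hle]
      have e1 : A * (s * cos β * cos ψ) ^ 2 + B * (s * cos β * sin ψ) ^ 2 =
          s ^ 2 * (cos β ^ 2 * angleForm A B (π / 2 - ψ)) := by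
        unfold angleForm; rw [sin_pi_div_two_sub, cos_pi_div_two_sub]; ring
      simp only [Matrix.cons_val_zero, Matrix.cons_val_one, Matrix.cons_val]
      rw [e1]
      have e2 : k * s ^ 2 ≤ s ^ 2 * (cos β ^ 2 * angleForm A B (π / 2 - ψ)) ↔
          sin β ^ 2 ≤ 1 - k / angleForm A B (π / 2 - ψ) := by
        rw [mul_comm k, mul_le_mul_iff_right₀ (by positivity), ← div_le_iff₀ hq0, cos_sq']
        constructor <;> intro h <;> linarith
      rw [e2]
      simp only [hs0, true_and, mul_nonneg_iff_of_pos_left hs0]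
  rw [Measure.real, Measure.toSphere_apply' _ hsm, hcone, hvol,
    setLIntegral_congr Ioo_ae_eq_Ioc, ← ofReal_integral_eq_lintegral_ofReal,
    ← intervalIntegral.integral_of_le (by linarith [pi_pos]), intervalIntegral.integral_div,
    intervalIntegral.integral_comp_sub_left (fun ψ => √(1 - k / angleForm A B ψ))]
  · have h := hper.intervalIntegral_add_eq (π / 2 - π) 0
    rw [show π / 2 - π + 2 * π = π / 2 - -π by ring, zero_add] at h
    rw [h, ENNReal.toReal_mul, ENNReal.toReal_ofReal]
    · simp
      ring
    · have := intervalIntegral.integral_nonneg (f := fun ψ => √(1 - k / angleForm A B ψ))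
        (a := 0) (b := 2 * π) (μ := volume) (by positivity) fun _ _ => sqrt_nonneg _
      positivity
  · refine (Continuous.intervalIntegrable ?_ _ _).1
    exact (hcont.comp (continuous_const.sub continuous_id)).div_const 3
  · exact Filter.Eventually.of_forall fun s => by positivity

/-! ### The period as an elliptic integral; differentiation in a parameter -/

section EllipticIntegral

variable {A B α D : ℝ}

/-- Both coefficients of the form exceed `D / α`, hence so does the form. For the top, this keeps
the orbit off the equator. -/
theorem heightSq_pos (hBA : B < A) (hD : 0 < D) (hDα : D < B * α) (hα : 0 < α) (ψ : ℝ) :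
    0 < α - D / angleForm A B ψ := by
  have hB : D / α < B := by rwa [div_lt_iff₀ hα]
  have h := lt_angleForm (hB.trans hBA) hB ψ
  have hq : 0 < angleForm A B ψ := (div_pos hD hα).trans h
  rw [sub_pos, div_lt_iff₀ hq]
  rwa [div_lt_iff₀ hα, mul_comm] at h

/-- This is the substitution `tan θ = τ tan x`. Writing `θ = x + arctan (N/M)`, with `N/M = tan (θ -
x)` and `M > 0`, makes it smooth up to the endpoint `π / 2`. -/
theorem integral_pi_div_two_rescale {τ : ℝ} (hτ : 0 < τ) {g : ℝ → ℝ}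
    (hg : Continuous fun θ => g (sin θ ^ 2)) :
    ∫ x in (0 : ℝ)..(π / 2), g (τ ^ 2 * sin x ^ 2 / (cos x ^ 2 + τ ^ 2 * sin x ^ 2)) *
      (τ / (cos x ^ 2 + τ ^ 2 * sin x ^ 2)) = ∫ θ in (0 : ℝ)..(π / 2), g (sin θ ^ 2) := by
  set N : ℝ → ℝ := fun x => (τ - 1) * (sin x * cos x) with hN
  set M : ℝ → ℝ := fun x => cos x ^ 2 + τ * sin x ^ 2 with hM
  set θ : ℝ → ℝ := fun x => x + arctan (N x / M x) with hθ
  have hMpos : ∀ x, 0 < M x := by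
    intro x
    have h := lt_angleForm (A := τ) (B := 1) hτ one_pos x
    simp only [angleForm] at h
    simp only [hM]; linarith
  have hS : ∀ x, 0 < cos x ^ 2 + τ ^ 2 * sin x ^ 2 := by
    intro x
    have h := lt_angleForm (A := τ ^ 2) (B := 1) (k := 0) (by positivity) one_pos x
    simp only [angleForm] at h
    linarith
  have hMN : ∀ x, M x ^ 2 + N x ^ 2 = cos x ^ 2 + τ ^ 2 * sin x ^ 2 := by
    intro x
    simp only [hM, hN]
    linear_combination (cos x ^ 2 + τ ^ 2 * sin x ^ 2) * sin_sq_add_cos_sq x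
  have hNd : ∀ x, HasDerivAt N ((τ - 1) * (cos x ^ 2 - sin x ^ 2)) x := fun x =>
    (((hasDerivAt_sin x).mul (hasDerivAt_cos x)).const_mul _).congr_deriv (by ring)
  have hMd : ∀ x, HasDerivAt M (2 * (τ - 1) * (sin x * cos x)) x := fun x =>
    (((hasDerivAt_cos x).pow 2).add (((hasDerivAt_sin x).pow 2).const_mul τ)).congr_deriv
      (by simp; ring)
  have hθd : ∀ x, HasDerivAt θ (τ / (cos x ^ 2 + τ ^ 2 * sin x ^ 2)) x := by
    intro x
    refine ((hasDerivAt_id x).add ((hNd x).div (hMd x) (hMpos x).ne').arctan).congr_deriv ?_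
    have h1 := hMN x
    have h2 := (hMpos x).ne'
    have h3 := (hS x).ne'
    have h4 : 1 + (N x / M x) ^ 2 = (cos x ^ 2 + τ ^ 2 * sin x ^ 2) / M x ^ 2 := by
      rw [← h1]; field_simp
    have h5 : (τ - 1) * (cos x ^ 2 - sin x ^ 2) * M x - N x * (2 * (τ - 1) * (sin x * cos x)) =
        τ - (cos x ^ 2 + τ ^ 2 * sin x ^ 2) := by
      simp only [hM, hN]
      linear_combination
        ((τ - 1) * (cos x ^ 2 - τ * sin x ^ 2) + τ) * sin_sq_add_cos_sq x
    simp only [Pi.div_apply]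
    rw [h4, h5]
    field_simp
    ring
  have hsin : ∀ x, sin (θ x) ^ 2 = τ ^ 2 * sin x ^ 2 / (cos x ^ 2 + τ ^ 2 * sin x ^ 2) := by
    intro x
    have h1 := hMN x
    have h2 := (hMpos x).ne'
    have h3 := (hS x).ne'
    have h4 : 1 + (N x / M x) ^ 2 = (cos x ^ 2 + τ ^ 2 * sin x ^ 2) / M x ^ 2 := by
      rw [← h1]; field_simp
    have h5 : sin x * M x + cos x * N x = τ * sin x := by
      simp only [hM, hN]
      linear_combination (τ * sin x) * sin_sq_add_cos_sq x
    have h6 : sin (θ x) = (τ * sin x / M x) / √(1 + (N x / M x) ^ 2) := by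
      simp only [hθ]
      rw [sin_add, sin_arctan, cos_arctan, ← h5]
      field_simp
    rw [h6, div_pow, sq_sqrt (by positivity), h4]
    field_simp
  have hc : Continuous fun x => τ / (cos x ^ 2 + τ ^ 2 * sin x ^ 2) :=
    continuous_const.div (by fun_prop) fun x => (hS x).ne'
  have h := intervalIntegral.integral_comp_mul_deriv (a := 0) (b := π / 2)
    (fun x _ => hθd x) hc.continuousOn hg
  have h0 : θ 0 = 0 := by simp [hθ, hN]
  have h1 : θ (π / 2) = π / 2 := by simp [hθ, hN]
  rw [h0, h1] at h
  rw [← h]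
  refine intervalIntegral.integral_congr fun x _ => ?_
  simp only [Function.comp_apply, hsin]

/-- The time of one turn as a complete elliptic integral. -/
theorem integral_period_eq_ellipticK (hB : 0 < B) (hBA : B < A) (hD : 0 < D) (hDα : D < B * α)
    (hα : 0 < α) :
    ∫ ψ in (0 : ℝ)..(2 * π), 1 / (angleForm A B ψ * √(α - D / angleForm A B ψ)) =
      4 / (√B * √(A * α - D)) * ellipticK (D * (A - B) / (B * (A * α - D))) := by
  set f : ℝ → ℝ := fun ψ => 1 / (angleForm A B ψ * √(α - D / angleForm A B ψ)) with hf
  have hA : 0 < A := hB.trans hBA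
  have hq : ∀ ψ, 0 < angleForm A B ψ := lt_angleForm hA hB
  have hz := heightSq_pos hBA hD hDα hα
  have hfc : Continuous f := by
    have h1 := continuous_angleForm A B
    exact continuous_const.div (h1.mul (continuous_const.sub
      (continuous_const.div h1 fun x => (hq x).ne')).sqrt)
      fun x => (mul_pos (hq x) (sqrt_pos.2 (hz x))).ne'
  have hper : Function.Periodic f π := fun x => by simp [hf, angleForm]
  have hrefl : ∀ x, f (π - x) = f x := fun x => by simp [hf, angleForm]
  have hAα : 0 < A * α - D := by nlinarith
  -- Period `π` and symmetry about `π / 2` reduce the turn to four equal quarters.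
  have h1 : ∫ ψ in (0 : ℝ)..(2 * π), f ψ = 4 * ∫ ψ in (0 : ℝ)..(π / 2), f ψ := by
    have e1 := hper.intervalIntegral_add_eq π 0
    rw [show π + π = 2 * π by ring, zero_add] at e1
    have e2 := intervalIntegral.integral_comp_sub_left (a := 0) (b := π / 2) f π
    simp only [hrefl] at e2
    rw [show π - π / 2 = π / 2 by ring, sub_zero] at e2
    rw [← intervalIntegral.integral_add_adjacent_intervals (hfc.intervalIntegrable 0 π)
      (hfc.intervalIntegrable π _), e1, ← intervalIntegral.integral_add_adjacent_intervals
      (hfc.intervalIntegrable 0 (π / 2)) (hfc.intervalIntegrable _ π), ← e2]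
    ring
  have h2 : ∫ ψ in (0 : ℝ)..(π / 2), f ψ = ∫ x in (0 : ℝ)..(π / 2), f (π / 2 - x) := by
    rw [intervalIntegral.integral_comp_sub_left f (π / 2)]
    simp
  have hBα : 0 < B * (A * α - D) := mul_pos hB hAα
  -- The parameter is below `1` precisely because `D < B α`.
  have hm : D * (A - B) / (B * (A * α - D)) < 1 := by
    rw [div_lt_one hBα]; nlinarith
  have hden : ∀ θ, 0 < 1 - D * (A - B) / (B * (A * α - D)) * sin θ ^ 2 := by
    intro θ
    have hm0 : 0 ≤ D * (A - B) / (B * (A * α - D)) :=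
      div_nonneg (mul_nonneg hD.le (by linarith)) hBα.le
    nlinarith [sin_sq_le_one θ, sq_nonneg (sin θ)]
  -- This choice of `τ` makes `cos² x + τ² sin² x` equal to the form at `π / 2 - x`, divided by `A`.
  have hτ : 0 < √(B / A) := sqrt_pos.2 (div_pos hB hA)
  have h3 := integral_pi_div_two_rescale hτ
    (g := fun y => 1 / √(1 - D * (A - B) / (B * (A * α - D)) * y))
    (continuous_const.div (Continuous.sqrt (by fun_prop)) fun θ => (sqrt_pos.2 (hden θ)).ne')
  rw [h1, h2, ellipticK, ← h3, div_mul_eq_mul_div, mul_div_assoc,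
    ← intervalIntegral.integral_div]
  congr 1
  refine intervalIntegral.integral_congr fun x _ => ?_
  simp only [hf, sq_sqrt (div_pos hB hA).le]
  have hqx := hq (π / 2 - x)
  have hzx := hz (π / 2 - x)
  set q := angleForm A B (π / 2 - x) with hqdef
  have hq' : q = A * cos x ^ 2 + B * sin x ^ 2 := by
    rw [hqdef, angleForm, sin_pi_div_two_sub, cos_pi_div_two_sub]
  have e1 : cos x ^ 2 + B / A * sin x ^ 2 = q / A := by rw [hq']; field_simp
  have e2 : 1 - D * (A - B) / (B * (A * α - D)) * (B / A * sin x ^ 2 / (q / A)) =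
      A * (α - D / q) / (A * α - D) := by
    field_simp
    rw [hq', cos_sq']
    ring
  rw [e1, e2, sqrt_div (mul_pos hA hzx).le, sqrt_mul hA.le, sqrt_div hB.le]
  have s1 := (sqrt_pos.2 hA).ne'
  have s2 := (sqrt_pos.2 hB).ne'
  have s3 := (sqrt_pos.2 hAα).ne'
  have s4 := (sqrt_pos.2 hzx).ne'
  have s5 : √A * √A = A := mul_self_sqrt hA.le
  generalize √(α - D / q) = z at s4
  generalize √(A * α - D) = y at s3
  field_simp
  rw [sq, s5]

/-- Differentiation of `∮ √(α - D / q) dψ` with respect to a parameter. -/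
theorem hasDerivAt_integral_height {a d a' d' : ℝ → ℝ} (ha : ∀ s, HasDerivAt a (a' s) s)
    (hd : ∀ s, HasDerivAt d (d' s) s) (ha' : Continuous a') (hd' : Continuous d')
    (hB : 0 < B) (hBA : B < A) {s₀ : ℝ} (ha0 : 0 < a s₀) (hd0 : 0 < d s₀)
    (hda : d s₀ < B * a s₀) :
    HasDerivAt (fun s => ∫ ψ in (0 : ℝ)..(2 * π), √(a s - d s / angleForm A B ψ))
      (∫ ψ in (0 : ℝ)..(2 * π), (a' s₀ - d' s₀ / angleForm A B ψ) /
        (2 * √(a s₀ - d s₀ / angleForm A B ψ))) s₀ := by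
  have hac : Continuous a := continuous_iff_continuousAt.2 fun t => (ha t).continuousAt
  have hdc : Continuous d := continuous_iff_continuousAt.2 fun t => (hd t).continuousAt
  have hq : ∀ ψ, 0 < angleForm A B ψ := lt_angleForm (hB.trans hBA) hB
  have hqc := continuous_angleForm A B
  -- The admissible parameters form an open set. On a closed ball inside it, times `[0, 2π]`, the
  -- derivative of the integrand is continuous, so compactness gives the dominating constant.
  have hU : IsOpen {s | 0 < a s ∧ 0 < d s ∧ d s < B * a s} := by
    have h1 : IsOpen {s | 0 < a s} := isOpen_lt continuous_const hac
    have h2 : IsOpen {s | 0 < d s} := isOpen_lt continuous_const hdc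
    have h3 : IsOpen {s | d s < B * a s} := isOpen_lt hdc (by fun_prop)
    exact h1.inter (h2.inter h3)
  obtain ⟨ε, hε, hball⟩ := Metric.nhds_basis_closedBall.mem_iff.1
    (hU.mem_nhds (show s₀ ∈ {s | 0 < a s ∧ 0 < d s ∧ d s < B * a s} from ⟨ha0, hd0, hda⟩))
  have hpos : ∀ s ∈ Metric.closedBall s₀ ε, ∀ ψ, 0 < a s - d s / angleForm A B ψ := by
    intro s hs ψ
    obtain ⟨h1, h2, h3⟩ := hball hs
    exact heightSq_pos hBA h2 h3 h1 ψ
  have hFc : ∀ s, Continuous fun ψ => √(a s - d s / angleForm A B ψ) := fun s =>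
    (continuous_const.sub (continuous_const.div hqc fun x => (hq x).ne')).sqrt
  have hF'c : ContinuousOn (fun p : ℝ × ℝ => (a' p.1 - d' p.1 / angleForm A B p.2) /
      (2 * √(a p.1 - d p.1 / angleForm A B p.2)))
      (Metric.closedBall s₀ ε ×ˢ Set.Icc 0 (2 * π)) := by
    have hq2 : Continuous fun p : ℝ × ℝ => angleForm A B p.2 := hqc.comp continuous_snd
    have h1 : Continuous fun p : ℝ × ℝ => a' p.1 - d' p.1 / angleForm A B p.2 :=
      (ha'.comp continuous_fst).sub ((hd'.comp continuous_fst).div hq2 fun p => (hq _).ne')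
    have h2 : Continuous fun p : ℝ × ℝ => 2 * √(a p.1 - d p.1 / angleForm A B p.2) :=
      continuous_const.mul ((hac.comp continuous_fst).sub
        ((hdc.comp continuous_fst).div hq2 fun p => (hq _).ne')).sqrt
    exact h1.continuousOn.div h2.continuousOn fun p hp =>
      (mul_pos two_pos (sqrt_pos.2 (hpos p.1 hp.1 p.2))).ne'
  obtain ⟨C, hC⟩ := ((isCompact_closedBall s₀ ε).prod isCompact_Icc).exists_bound_of_continuousOn
    hF'c
  have hpi := pi_pos
  have hF0 : Continuous fun ψ => (a' s₀ - d' s₀ / angleForm A B ψ) /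
      (2 * √(a s₀ - d s₀ / angleForm A B ψ)) :=
    (continuous_const.sub (continuous_const.div hqc fun x => (hq x).ne')).div
      (continuous_const.mul (hFc s₀)) fun ψ =>
        (mul_pos two_pos (sqrt_pos.2 (hpos s₀ (Metric.mem_closedBall_self hε.le) ψ))).ne'
  refine (intervalIntegral.hasDerivAt_integral_of_dominated_loc_of_deriv_le
    (F' := fun s ψ => (a' s - d' s / angleForm A B ψ) / (2 * √(a s - d s / angleForm A B ψ)))
    (bound := fun _ => C) (Metric.closedBall_mem_nhds s₀ hε)
    (Filter.Eventually.of_forall fun s => (hFc s).aestronglyMeasurable)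
    ((hFc s₀).intervalIntegrable _ _) hF0.aestronglyMeasurable ?_ (by simp) ?_).2
  · refine Filter.Eventually.of_forall fun ψ hψ s hs => hC (s, ψ) ⟨hs, ?_⟩
    rw [Set.uIoc_of_le (by positivity)] at hψ
    exact ⟨hψ.1.le, hψ.2⟩
  · refine Filter.Eventually.of_forall fun ψ hψ s hs => ?_
    exact ((ha s).sub ((hd s).div_const _)).sqrt (hpos s hs ψ).ne'

end EllipticIntegral

/-! ### Rotations and the speed of the somersault angle -/

section Rotation

variable {M : Matrix (Fin 3) (Fin 3) ℝ}

theorem dotProduct_rotation (hM : M ∈ Matrix.specialOrthogonalGroup (Fin 3) ℝ) (a b : Vec3) :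
    M *ᵥ a ⬝ᵥ M *ᵥ b = a ⬝ᵥ b := by
  have h := (Matrix.mem_orthogonalGroup_iff' (Fin 3) ℝ).1
    (Matrix.mem_specialOrthogonalGroup_iff.1 hM).1
  rw [Matrix.dotProduct_mulVec, Matrix.vecMul_mulVec, ← Matrix.dotProduct_mulVec]
  have h' : Mᵀ * M = 1 := h
  rw [h', Matrix.one_mulVec]

theorem tripleProduct_rotation (hM : M ∈ Matrix.specialOrthogonalGroup (Fin 3) ℝ)
    (a b d : Vec3) : M *ᵥ a ⬝ᵥ ((M *ᵥ b) ⨯₃ (M *ᵥ d)) = a ⬝ᵥ (b ⨯₃ d) := by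
  have hdet := (Matrix.mem_specialOrthogonalGroup_iff.1 hM).2
  have h : Matrix.of ![M *ᵥ a, M *ᵥ b, M *ᵥ d] = Matrix.of ![a, b, d] * Mᵀ := by
    ext i j
    fin_cases i <;>
      simp [Matrix.mul_apply, Matrix.mulVec, dotProduct, Fin.sum_univ_three, mul_comm]
  rw [triple_product_eq_det, triple_product_eq_det]
  refine (congrArg Matrix.det h).trans ?_
  rw [Matrix.det_mul, Matrix.det_transpose, hdet, mul_one]
  rfl

/-- Pythagoras in the frame `u`, `v`, `u × v`, obtained from Lagrange's identity for `n × (u × v)`.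
-/
theorem sq_add_sq_of_orthonormal {u v n : Vec3} (hu : u ⬝ᵥ u = 1) (hv : v ⬝ᵥ v = 1)
    (huv : u ⬝ᵥ v = 0) :
    (u ⬝ᵥ n) ^ 2 + (v ⬝ᵥ n) ^ 2 = n ⬝ᵥ n - (n ⬝ᵥ (u ⨯₃ v)) ^ 2 := by
  have hvu : v ⬝ᵥ u = 0 := by rw [dotProduct_comm, huv]
  have h1 := cross_dot_cross n (u ⨯₃ v) n (u ⨯₃ v)
  rw [cross_dot_cross u v u v, hu, hv, huv, hvu, cross_cross_eq_smul_sub_smul',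
    dotProduct_comm (u ⨯₃ v) n] at h1
  simp only [sub_dotProduct, dotProduct_sub, smul_dotProduct, dotProduct_smul, smul_eq_mul,
    hu, hv, huv, hvu] at h1
  rw [dotProduct_comm n v] at h1
  linarith

end Rotation

/-- The derivative of the somersault angle. -/
theorem hasDerivAt_somersaultAngle {J : Vec3} {l : ℝ} (hl : 0 < l) {L : ℝ → Vec3}
    {R : ℝ → Matrix (Fin 3) (Fin 3) ℝ} {p : Vec3} {φ : ℝ → ℝ}
    (hnorm : ∀ t, L t ⬝ᵥ L t = l ^ 2) (hR : IsAttitude J L R p) (hφ : IsSomersaultAngle R p φ)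
    (t : ℝ) :
    HasDerivAt φ (l * (L t 0 ^ 2 / J 0 + L t 1 ^ 2 / J 1) / (L t 0 ^ 2 + L t 1 ^ 2)) t := by
  obtain ⟨hφc, u, v, hu, hv, huv, ⟨c, hc, hp⟩, h⟩ := hφ
  have hvu : v ⬝ᵥ u = 0 := by rw [dotProduct_comm, huv]
  have hpp : p ⬝ᵥ p = c ^ 2 := by
    rw [hp, smul_dotProduct, dotProduct_smul, cross_dot_cross, hu, hv, huv, hvu]
    simp [sq]
  -- Rotations preserve length, so the factor in `p = c (u × v)` is `|L| = l`.
  have hcl : c = l := by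
    have h1 : p ⬝ᵥ p = l ^ 2 := by
      rw [← hR.momentum 0, dotProduct_rotation (hR.rotation 0), hnorm 0]
    rw [hpp] at h1
    exact (pow_left_inj₀ hc.le hl.le two_ne_zero).1 h1
  subst hcl
  have hup : u ⬝ᵥ p = 0 := by rw [hp, dotProduct_smul, dot_self_cross, smul_zero]
  have hvp : v ⬝ᵥ p = 0 := by rw [hp, dotProduct_smul, dot_cross_self, smul_zero]
  set e : Vec3 := ![0, 0, 1] with he
  set n' : Vec3 := R t *ᵥ (angVel J (L t) ⨯₃ e) with hn'
  have hd : ∀ w : Vec3, HasDerivAt (fun s => w ⬝ᵥ R s *ᵥ e) (w ⬝ᵥ n') t := by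
    intro w
    have h1 := hasDerivAt_pi.1 (hR.kinematic e t)
    simp only [dotProduct, Fin.sum_univ_three]
    exact (((h1 0).const_mul _).add ((h1 1).const_mul _)).add ((h1 2).const_mul _)
  have hXY : ∀ s, ∃ r : ℝ, 0 < r ∧ u ⬝ᵥ R s *ᵥ e = r * cos (φ s) ∧
      v ⬝ᵥ R s *ᵥ e = r * sin (φ s) := by
    intro s
    obtain ⟨r, d, hr, hs⟩ := h s
    refine ⟨r, hr, ?_, ?_⟩
    · rw [hs]; simp [dotProduct_add, dotProduct_smul, hu, huv, hup]
    · rw [hs]; simp [dotProduct_add, dotProduct_smul, hv, hvu, hvp]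
  refine (hasDerivAt_polarAngle (hd u) (hd v) hφc.continuousAt hXY).congr_deriv ?_
  -- The numerator of the angular speed, times `c`, is the triple product of `p`, `R e_z` and its
  -- velocity. Rotation invariance moves it to the body frame, where it is `L · (e_z × (Ω × e_z)) =
  -- L_x Ω_x + L_y Ω_y`.
  have hnum : c * ((u ⬝ᵥ R t *ᵥ e) * (v ⬝ᵥ n') - (v ⬝ᵥ R t *ᵥ e) * (u ⬝ᵥ n')) =
      L t 0 ^ 2 / J 0 + L t 1 ^ 2 / J 1 := by
    have h1 : p ⬝ᵥ ((R t *ᵥ e) ⨯₃ n') = L t ⬝ᵥ (e ⨯₃ (angVel J (L t) ⨯₃ e)) := by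
      rw [← hR.momentum t, hn', tripleProduct_rotation (hR.rotation t)]
    have h2 : p ⬝ᵥ ((R t *ᵥ e) ⨯₃ n') =
        c * ((u ⬝ᵥ R t *ᵥ e) * (v ⬝ᵥ n') - (v ⬝ᵥ R t *ᵥ e) * (u ⬝ᵥ n')) := by
      rw [hp, smul_dotProduct, cross_dot_cross, smul_eq_mul]
      ring
    rw [← h2, h1]
    simp [he, cross_apply, dotProduct, Fin.sum_univ_three, angVel]
    ring
  have hn := hnorm t
  simp only [dotProduct, Fin.sum_univ_three] at hn
  -- The component of `R e_z` along `p / |p|` is `L_z / l`, so its part orthogonal to `p` has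
  -- squared length `1 - L_z² / l²`.
  have hden : (u ⬝ᵥ R t *ᵥ e) ^ 2 + (v ⬝ᵥ R t *ᵥ e) ^ 2 = (L t 0 ^ 2 + L t 1 ^ 2) / c ^ 2 := by
    rw [sq_add_sq_of_orthonormal hu hv huv, dotProduct_rotation (hR.rotation t)]
    have h1 : R t *ᵥ e ⬝ᵥ p = L t 2 := by
      rw [← hR.momentum t, dotProduct_rotation (hR.rotation t)]
      simp [he, dotProduct, Fin.sum_univ_three]
    have h2 : R t *ᵥ e ⬝ᵥ (u ⨯₃ v) = L t 2 / c := by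
      rw [← h1, hp, dotProduct_smul, smul_eq_mul]
      field_simp
    rw [h2]
    have h3 : e ⬝ᵥ e = 1 := by simp [he, dotProduct, Fin.sum_univ_three]
    rw [h3]
    field_simp
    linarith
  have hpos : 0 < L t 0 ^ 2 + L t 1 ^ 2 := by
    obtain ⟨r, hr, h1, h2⟩ := hXY t
    rw [h1, h2, show (r * cos (φ t)) ^ 2 + (r * sin (φ t)) ^ 2 = r ^ 2 by
      linear_combination r ^ 2 * sin_sq_add_cos_sq (φ t)] at hden
    have : 0 < r ^ 2 := by positivity
    rw [hden] at this
    exact (div_pos_iff_of_pos_right (by positivity)).1 this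
  rw [hden, ← hnum]
  field_simp

/-! ### The energy relation and the formulas for `S` and `T` -/

/-- The coefficients of the energy relation `A L_x² + B L_y² = D` of the Euler top. -/
noncomputable def topA (J : Vec3) : ℝ := topSign J * (1 / J 2 - 1 / J 0)

noncomputable def topB (J : Vec3) : ℝ := topSign J * (1 / J 2 - 1 / J 1)

noncomputable def topD (J : Vec3) (E l : ℝ) : ℝ := topSign J * (l ^ 2 / J 2 - 2 * E)

/-- Motions around the `z`-axis. -/
structure ZRegime (J : Vec3) (E l : ℝ) (n : ℤ) : Prop where
  pos : ∀ i, 0 < J i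
  l_pos : 0 < l
  -- The sign is kept as an integer because it enters the number of turns of the twist angle in one
  -- period.
  sign : topSign J = n
  unit : n * n = 1
  B_pos : 0 < topB J
  B_lt_A : topB J < topA J
  D_pos : 0 < topD J E l
  D_lt : topD J E l < topB J * l ^ 2

/-- The two orderings merge: the bound on `E` by `l² / (2 J_z)` says `D > 0`, and the one by `l² /
(2 J_y)` says `D < B l²`. -/
theorem exists_zRegime {J : Vec3} {E l : ℝ} (hJ : ∀ i, 0 < J i) (hl : 0 < l)
    (hcase : (J 2 < J 1 ∧ J 1 < J 0 ∧ l ^ 2 / (2 * J 1) < E ∧ E < l ^ 2 / (2 * J 2)) ∨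
      (J 0 < J 1 ∧ J 1 < J 2 ∧ l ^ 2 / (2 * J 2) < E ∧ E < l ^ 2 / (2 * J 1))) :
    ∃ n : ℤ, ZRegime J E l n := by
  have e1 : l ^ 2 / (2 * J 1) = l ^ 2 / J 1 / 2 := by rw [mul_comm, div_mul_eq_div_div]
  have e2 : l ^ 2 / (2 * J 2) = l ^ 2 / J 2 / 2 := by rw [mul_comm, div_mul_eq_div_div]
  have e3 : l ^ 2 / J 1 = 1 / J 1 * l ^ 2 := by ring
  have e4 : l ^ 2 / J 2 = 1 / J 2 * l ^ 2 := by ring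
  rw [e1, e2] at hcase
  rcases hcase with ⟨h1, h2, h3, h4⟩ | ⟨h1, h2, h3, h4⟩
  · have hs : topSign J = 1 := Real.sign_of_pos (by linarith)
    have i1 := one_div_lt_one_div_of_lt (hJ 2) h1
    have i2 := one_div_lt_one_div_of_lt (hJ 1) h2
    refine ⟨1, hJ, hl, by simp [hs], by norm_num, ?_, ?_, ?_, ?_⟩ <;>
      simp only [topA, topB, topD, hs] <;> linarith
  · have hs : topSign J = -1 := Real.sign_of_neg (by linarith)
    have i1 := one_div_lt_one_div_of_lt (hJ 0) h1
    have i2 := one_div_lt_one_div_of_lt (hJ 1) h2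
    refine ⟨-1, hJ, hl, by simp [hs], by norm_num, ?_, ?_, ?_, ?_⟩ <;>
      simp only [topA, topB, topD, hs] <;> linarith

namespace ZRegime

variable {J : Vec3} {E l : ℝ} {n : ℤ}

theorem sign_mul_self (h : ZRegime J E l n) : topSign J * topSign J = 1 := by
  rw [h.sign]; exact_mod_cast h.unit

theorem form_pos (h : ZRegime J E l n) (ψ : ℝ) : 0 < angleForm (topA J) (topB J) ψ :=
  lt_angleForm (h.B_pos.trans h.B_lt_A) h.B_pos ψ

theorem height_pos (h : ZRegime J E l n) (ψ : ℝ) :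
    0 < l ^ 2 - topD J E l / angleForm (topA J) (topB J) ψ :=
  heightSq_pos h.B_lt_A h.D_pos h.D_lt (pow_pos h.l_pos 2) ψ

/-- Once `u_z` is eliminated through `|u| = 1`, the condition `σ (H - E) ≤ 0` becomes a quadratic
cone condition with threshold `D / l²`. -/
theorem solidAngle_eq (h : ZRegime J E l n) :
    l * solidAngle J E l = topSign J *
      ∫ ψ in (0 : ℝ)..(2 * π), √(l ^ 2 - topD J E l / angleForm (topA J) (topB J) ψ) := by
  have hl := h.l_pos
  have hl2 : 0 < l ^ 2 := pow_pos hl 2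
  have hk : topD J E l / l ^ 2 < topB J := by rw [div_lt_iff₀ hl2]; exact h.D_lt
  have hreg : equatorialRegion J E l = {u : Metric.sphere (0 : EuclideanSpace ℝ (Fin 3)) 1 |
      0 ≤ (u : EuclideanSpace ℝ (Fin 3)) 2 ∧
        topD J E l / l ^ 2 ≤ topA J * (u : EuclideanSpace ℝ (Fin 3)) 0 ^ 2 +
          topB J * (u : EuclideanSpace ℝ (Fin 3)) 1 ^ 2} := by
    ext u
    have hu : (u : EuclideanSpace ℝ (Fin 3)) 0 ^ 2 + (u : EuclideanSpace ℝ (Fin 3)) 1 ^ 2 +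
        (u : EuclideanSpace ℝ (Fin 3)) 2 ^ 2 = 1 := by
      have h1 := EuclideanSpace.real_norm_sq_eq (u : EuclideanSpace ℝ (Fin 3))
      rw [norm_eq_of_mem_sphere, Fin.sum_univ_three] at h1
      linarith
    refine and_congr Iff.rfl ?_
    rw [div_le_iff₀ hl2]
    have key : (topA J * (u : EuclideanSpace ℝ (Fin 3)) 0 ^ 2 +
        topB J * (u : EuclideanSpace ℝ (Fin 3)) 1 ^ 2) * l ^ 2 - topD J E l =
        -2 * (topSign J *
          (energy J (fun i => l * (u : EuclideanSpace ℝ (Fin 3)) i) - E)) := by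
      simp only [topA, topB, topD, energy, angVel, dotProduct, Fin.sum_univ_three]
      linear_combination (topSign J * l ^ 2 / J 2) * hu
    constructor <;> intro h' <;> linarith
  rw [solidAngle, hreg, toSphere_real_cone (div_pos h.D_pos hl2) (hk.trans h.B_lt_A) hk,
    mul_left_comm, ← intervalIntegral.integral_const_mul]
  congr 1
  refine intervalIntegral.integral_congr fun ψ _ => ?_
  have hq := (h.form_pos ψ).ne'
  have e : l ^ 2 - topD J E l / angleForm (topA J) (topB J) ψ =
      l ^ 2 * (1 - topD J E l / l ^ 2 / angleForm (topA J) (topB J) ψ) := by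
    field_simp
  rw [e, sqrt_mul hl2.le, sqrt_sq hl.le]

theorem topPeriod_eq (h : ZRegime J E l n) :
    topPeriod J E l = ∫ ψ in (0 : ℝ)..(2 * π), 1 / (angleForm (topA J) (topB J) ψ *
      √(l ^ 2 - topD J E l / angleForm (topA J) (topB J) ψ)) := by
  have hl := h.l_pos
  have hB := h.B_pos
  have hAB : 0 < topA J - topB J := sub_pos.2 h.B_lt_A
  have hD := h.D_pos
  have hDl := h.D_lt
  have hl2 : 0 < l ^ 2 := pow_pos hl 2
  have hAα : 0 < topA J * l ^ 2 - topD J E l := by nlinarith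
  have h0 := h.pos 0
  have h1 := h.pos 1
  have h2 := h.pos 2
  have hσ := h.sign_mul_self
  rw [integral_period_eq_ellipticK hB h.B_lt_A hD hDl hl2]
  -- In these three roots, `μ = J_y u v`, `ρ = u / v` and `g = l u / w`. Both factors under the
  -- roots in `μ` and `ρ` carry the sign `-σ`, which cancels.
  set u := √(topA J - topB J) with hu
  set v := √(topB J) with hv
  set w := √(topA J * l ^ 2 - topD J E l) with hw
  have hupos : 0 < u := sqrt_pos.2 hAB
  have hvpos : 0 < v := sqrt_pos.2 hB
  have hwpos : 0 < w := sqrt_pos.2 hAα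
  have hu2 : u ^ 2 = topA J - topB J := sq_sqrt hAB.le
  have hv2 : v ^ 2 = topB J := sq_sqrt hB.le
  have hw2 : w ^ 2 = topA J * l ^ 2 - topD J E l := sq_sqrt hAα.le
  have eu : J 1 / J 0 - 1 = -topSign J * J 1 * u ^ 2 := by
    rw [hu2, topA, topB]
    have : -topSign J * J 1 * (topSign J * (1 / J 2 - 1 / J 0) - topSign J * (1 / J 2 - 1 / J 1))
      = -(topSign J * topSign J) * (J 1 * (1 / J 1 - 1 / J 0)) := by ring
    rw [this, hσ]
    field_simp
    ring
  have ev : 1 - J 1 / J 2 = -topSign J * J 1 * v ^ 2 := by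
    rw [hv2, topB]
    have : -topSign J * J 1 * (topSign J * (1 / J 2 - 1 / J 1))
      = -(topSign J * topSign J) * (J 1 * (1 / J 2 - 1 / J 1)) := by ring
    rw [this, hσ]
    field_simp
    ring
  have hs0 : topSign J ≠ 0 := left_ne_zero_of_mul (hσ.trans_ne one_ne_zero)
  have hμ : topMu J = J 1 * u * v := by
    rw [topMu, eu, ev, show -topSign J * J 1 * u ^ 2 * (-topSign J * J 1 * v ^ 2) =
      (topSign J * topSign J) * (J 1 * u * v) ^ 2 by ring, hσ, one_mul, sqrt_sq (by positivity)]
  have hρ : topRho J = u / v := by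
    rw [topRho, eu, ev, show -topSign J * J 1 * u ^ 2 / (-topSign J * J 1 * v ^ 2) =
      (u / v) ^ 2 by field_simp, sqrt_sq (by positivity)]
  have hh : topH J E l = (v ^ 2 * l ^ 2 - topD J E l) / (2 * l ^ 2 * u * v) := by
    have : topSign J * (2 * E * J 1 / l ^ 2 - 1) = J 1 * (v ^ 2 * l ^ 2 - topD J E l) / l ^ 2 := by
      rw [hv2, topB, topD]
      field_simp
      ring
    rw [topH, this, hμ]
    field_simp
  have hw2' : w ^ 2 = u ^ 2 * l ^ 2 + v ^ 2 * l ^ 2 - topD J E l := by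
    rw [hw2, hu2, hv2]; ring
  have hden : 1 + 2 * topH J E l / topRho J = (w / (l * u)) ^ 2 := by
    rw [hh, hρ, div_pow, hw2']
    field_simp
    ring
  have hg : topG J E l = l * u / w := by
    rw [topG, hden, sqrt_sq (by positivity), one_div_div]
  have hden' : 2 * topH J E l + topRho J = w ^ 2 / (l ^ 2 * u * v) := by
    rw [hh, hρ, hw2']
    field_simp
    ring
  have hm : topM J E l = topD J E l * (topA J - topB J) /
      (topB J * (topA J * l ^ 2 - topD J E l)) := by
    rw [topM, hden', ← hu2, ← hv2, ← hw2, hh, hρ]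
    field_simp
    ring
  rw [topPeriod, hm, hg, hμ]
  field_simp

end ZRegime

/-! ### Conservation laws -/

namespace IsEulerSolution

variable {J : Vec3} {L : ℝ → Vec3}

theorem hasDerivAt_components (hL : IsEulerSolution J L) (t : ℝ) :
    HasDerivAt (fun s => L s 0) (L t 1 * L t 2 * (1 / J 2 - 1 / J 1)) t ∧
    HasDerivAt (fun s => L s 1) (L t 0 * L t 2 * (1 / J 0 - 1 / J 2)) t ∧
    HasDerivAt (fun s => L s 2) (L t 0 * L t 1 * (1 / J 1 - 1 / J 0)) t := by
  have h := hasDerivAt_pi.1 (hL t)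
  refine ⟨(h 0).congr_deriv ?_, (h 1).congr_deriv ?_, (h 2).congr_deriv ?_⟩ <;>
    simp [cross_apply, angVel] <;> ring

theorem dotProduct_self_eq (hL : IsEulerSolution J L) (t : ℝ) :
    L t ⬝ᵥ L t = L 0 ⬝ᵥ L 0 := by
  have hd : ∀ t, HasDerivAt (fun s => L s ⬝ᵥ L s) 0 t := by
    intro t
    obtain ⟨h0, h1, h2⟩ := hL.hasDerivAt_components t
    simp only [dotProduct, Fin.sum_univ_three]
    exact (((h0.mul h0).add (h1.mul h1)).add (h2.mul h2)).congr_deriv (by ring)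
  exact is_const_of_deriv_eq_zero (fun t => (hd t).differentiableAt) (fun t => (hd t).deriv) t 0

theorem energy_eq (hL : IsEulerSolution J L) (t : ℝ) : energy J (L t) = energy J (L 0) := by
  have hd : ∀ t, HasDerivAt (fun s => energy J (L s)) 0 t := by
    intro t
    obtain ⟨h0, h1, h2⟩ := hL.hasDerivAt_components t
    simp only [energy, angVel, dotProduct, Fin.sum_univ_three]
    exact ((((h0.mul (h0.div_const _)).add (h1.mul (h1.div_const _))).add
      (h2.mul (h2.div_const _))).div_const 2).congr_deriv (by ring)
  exact is_const_of_deriv_eq_zero (fun t => (hd t).differentiableAt) (fun t => (hd t).deriv) t 0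

theorem continuous (hL : IsEulerSolution J L) : Continuous L :=
  continuous_iff_continuousAt.2 fun t => (hL t).continuousAt

theorem relations {E l : ℝ} (hL : IsEulerSolution J L) (hl : L 0 ⬝ᵥ L 0 = l ^ 2)
    (hE : energy J (L 0) = E) (t : ℝ) :
    L t 0 ^ 2 + L t 1 ^ 2 + L t 2 ^ 2 = l ^ 2 ∧
      topA J * L t 0 ^ 2 + topB J * L t 1 ^ 2 = topD J E l := by
  have h1 := (hL.dotProduct_self_eq t).trans hl
  have h2 := (hL.energy_eq t).trans hE
  simp only [energy, angVel, dotProduct, Fin.sum_univ_three] at h1 h2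
  have h1' : L t 0 ^ 2 + L t 1 ^ 2 + L t 2 ^ 2 = l ^ 2 := by linarith
  refine ⟨h1', ?_⟩
  simp only [topA, topB, topD]
  rw [← h1', ← h2]
  ring

end IsEulerSolution

/-! ### Reduction to a flow of the twist angle; period and action -/

/-- The height `|L_z|` of the orbit as a function of the twist angle. -/
noncomputable def twistHeight (J : Vec3) (E l x : ℝ) : ℝ :=
  √(l ^ 2 - topD J E l / angleForm (topA J) (topB J) x)

/-- The speed of the twist angle. -/
noncomputable def twistSpeed (J : Vec3) (E l x : ℝ) : ℝ :=
  angleForm (topA J) (topB J) x * twistHeight J E l x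

namespace ZRegime

variable {J : Vec3} {E l : ℝ} {n : ℤ} {L : ℝ → Vec3}

theorem exists_twistAngle (h : ZRegime J E l n) (hL : IsEulerSolution J L)
    (hl : L 0 ⬝ᵥ L 0 = l ^ 2) (hE : energy J (L 0) = E) : ∃ ψ, IsTwistAngle L ψ := by
  have hc := hL.continuous
  have hci : ∀ i, Continuous fun s => L s i := fun i => (continuous_apply i).comp hc
  -- The twist angle is measured from the `y`-axis, so `L_y` plays the role of the abscissa. The
  -- projected curve avoids the origin because `D > 0`.
  obtain ⟨ψ, hψ, hs⟩ := exists_polarAngle (fun t => (hL.hasDerivAt_components t).2.1)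
    (fun t => (hL.hasDerivAt_components t).1)
    (((hci 0).mul (hci 2)).mul continuous_const) (((hci 1).mul (hci 2)).mul continuous_const)
    (fun t h0 => by
      have h1 := (hL.relations hl hE t).2
      have h2 := h.D_pos
      have h3 : L t 0 ^ 2 = 0 := by nlinarith [sq_nonneg (L t 0), sq_nonneg (L t 1)]
      have h4 : L t 1 ^ 2 = 0 := by nlinarith [sq_nonneg (L t 0), sq_nonneg (L t 1)]
      rw [h3, h4] at h1
      linarith)
  exact ⟨ψ, hψ, fun t => by
    obtain ⟨r, hr, h1, h2⟩ := hs t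
    exact ⟨r, hr, h2, h1⟩⟩

/-- The motion as a flow on the circle of the twist angle. -/
theorem twistAngle_flow (h : ZRegime J E l n) (hL : IsEulerSolution J L)
    (hl : L 0 ⬝ᵥ L 0 = l ^ 2) (hE : energy J (L 0) = E) {ψ : ℝ → ℝ} (hψ : IsTwistAngle L ψ) :
    ∃ ε : ℤ, ε * ε = 1 ∧ ∀ t,
      L t 0 = √(topD J E l / angleForm (topA J) (topB J) (ψ t)) * sin (ψ t) ∧
      L t 1 = √(topD J E l / angleForm (topA J) (topB J) (ψ t)) * cos (ψ t) ∧
      L t 2 = ε * twistHeight J E l (ψ t) ∧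
      HasDerivAt ψ (((n * ε : ℤ) : ℝ) * twistSpeed J E l (ψ t)) t := by
  have hr : ∀ t, ∃ r : ℝ, 0 < r ∧ L t 0 = r * sin (ψ t) ∧ L t 1 = r * cos (ψ t) ∧
      r ^ 2 = topD J E l / angleForm (topA J) (topB J) (ψ t) ∧
      L t 2 ^ 2 = l ^ 2 - topD J E l / angleForm (topA J) (topB J) (ψ t) := by
    intro t
    obtain ⟨r, hr, h0, h1⟩ := hψ.2 t
    obtain ⟨e1, e2⟩ := hL.relations hl hE t
    have e3 : r ^ 2 = topD J E l / angleForm (topA J) (topB J) (ψ t) := by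
      rw [eq_div_iff (h.form_pos _).ne', ← e2, h0, h1, angleForm]
      ring
    refine ⟨r, hr, h0, h1, e3, ?_⟩
    rw [← e3, ← e1, h0, h1]
    linear_combination (-r ^ 2) * sin_sq_add_cos_sq (ψ t)
  have hz : Continuous fun t => L t 2 := (continuous_apply 2).comp hL.continuous
  have hz0 : ∀ t, L t 2 ≠ 0 := by
    intro t h0
    obtain ⟨r, -, -, -, -, h4⟩ := hr t
    have := h.height_pos (ψ t)
    rw [← h4, h0] at this
    norm_num at this
  -- `L_z` never vanishes, so its sign `ε` is constant; it tells which of the two orbits is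
  -- traversed.
  have hsign : ∃ ε : ℤ, ε * ε = 1 ∧ ∀ t, 0 < ε * L t 2 := by
    have hivt : ∀ s t, L s 2 < 0 → ¬ 0 < L t 2 := by
      intro s t hs ht
      obtain ⟨x, hx⟩ := mem_range_of_exists_le_of_exists_ge hz ⟨s, hs.le⟩ ⟨t, ht.le⟩
      exact hz0 x hx
    rcases lt_or_gt_of_ne (hz0 0) with h0 | h0
    · refine ⟨-1, by norm_num, fun t => ?_⟩
      have := lt_of_le_of_ne (not_lt.1 (hivt 0 t h0)) (hz0 t)
      push_cast; linarith
    · refine ⟨1, by norm_num, fun t => ?_⟩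
      have := lt_of_le_of_ne (not_lt.1 fun ht => hivt t 0 ht h0) (hz0 t).symm
      push_cast; linarith
  obtain ⟨ε, hε, hεz⟩ := hsign
  have hε' : (ε : ℝ) * ε = 1 := by exact_mod_cast hε
  refine ⟨ε, hε, fun t => ?_⟩
  obtain ⟨r, hr0, h0, h1, h2, h3⟩ := hr t
  have hz3 : L t 2 = ε * √(l ^ 2 - topD J E l / angleForm (topA J) (topB J) (ψ t)) := by
    have : √(l ^ 2 - topD J E l / angleForm (topA J) (topB J) (ψ t)) = ε * L t 2 := by
      rw [← h3, show L t 2 ^ 2 = (ε * L t 2) ^ 2 by linear_combination (-L t 2 ^ 2) * hε',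
        sqrt_sq (hεz t).le]
    rw [this, ← mul_assoc, hε', one_mul]
  have hr1 : √(topD J E l / angleForm (topA J) (topB J) (ψ t)) = r := by
    rw [← h2, sqrt_sq hr0.le]
  refine ⟨by rw [hr1]; exact h0, by rw [hr1]; exact h1, hz3, ?_⟩
  obtain ⟨d0, d1, -⟩ := hL.hasDerivAt_components t
  refine (hasDerivAt_polarAngle d1 d0 hψ.1.continuousAt fun s => ?_).congr_deriv ?_
  · obtain ⟨r, hr, h1, h2⟩ := hψ.2 s
    exact ⟨r, hr, h2, h1⟩
  · have hσ := h.sign_mul_self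
    -- The numerator of `ψ'` is `L_z` times the right-hand side, so this identity gives `ψ' = σ q(ψ)
    -- L_z`.
    have hform : topSign J * angleForm (topA J) (topB J) (ψ t) * (L t 0 ^ 2 + L t 1 ^ 2) =
        (1 / J 2 - 1 / J 0) * L t 0 ^ 2 + (1 / J 2 - 1 / J 1) * L t 1 ^ 2 := by
      have e : L t 0 ^ 2 + L t 1 ^ 2 = r ^ 2 := by
        rw [h0, h1]; linear_combination r ^ 2 * sin_sq_add_cos_sq (ψ t)
      rw [e, h0, h1, angleForm, topA, topB]
      linear_combination (r ^ 2 * ((1 / J 2 - 1 / J 0) * sin (ψ t) ^ 2 +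
        (1 / J 2 - 1 / J 1) * cos (ψ t) ^ 2)) * hσ
    have hne : L t 1 ^ 2 + L t 0 ^ 2 ≠ 0 := by
      have e : L t 1 ^ 2 + L t 0 ^ 2 = r ^ 2 := by
        rw [h0, h1]; linear_combination r ^ 2 * sin_sq_add_cos_sq (ψ t)
      rw [e]; positivity
    rw [div_eq_iff hne]
    rw [twistSpeed, twistHeight]
    push_cast
    rw [← h.sign]
    linear_combination (-L t 2) * hform - topSign J * angleForm (topA J) (topB J) (ψ t) *
      (L t 0 ^ 2 + L t 1 ^ 2) * (-hz3)

theorem int_unit (h : ZRegime J E l n) {ε : ℤ} (hε : ε * ε = 1) : (n * ε) * (n * ε) = 1 := by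
  calc (n * ε) * (n * ε) = (n * n) * (ε * ε) := by ring
    _ = 1 := by rw [h.unit, hε, one_mul]

theorem twistHeight_pos (h : ZRegime J E l n) (x : ℝ) : 0 < twistHeight J E l x :=
  sqrt_pos.2 (h.height_pos x)

theorem continuous_twistHeight (h : ZRegime J E l n) : Continuous (twistHeight J E l) :=
  (continuous_const.sub (continuous_const.div (continuous_angleForm _ _)
    fun x => (h.form_pos x).ne')).sqrt

theorem twistHeight_periodic : Function.Periodic (twistHeight J E l) (2 * π) := fun x => by
  simp only [twistHeight, angleForm_periodic _ _ x]

theorem twistSpeed_pos (h : ZRegime J E l n) (x : ℝ) : 0 < twistSpeed J E l x :=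
  mul_pos (h.form_pos x) (h.twistHeight_pos x)

theorem continuous_twistSpeed (h : ZRegime J E l n) : Continuous (twistSpeed J E l) :=
  (continuous_angleForm _ _).mul h.continuous_twistHeight

theorem twistSpeed_periodic : Function.Periodic (twistSpeed J E l) (2 * π) :=
  (angleForm_periodic _ _).mul twistHeight_periodic

theorem topPeriod_eq_integral_twistSpeed (h : ZRegime J E l n) :
    topPeriod J E l = ∫ x in (0 : ℝ)..(2 * π), 1 / twistSpeed J E l x :=
  h.topPeriod_eq

theorem topPeriod_pos (h : ZRegime J E l n) : 0 < topPeriod J E l := by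
  rw [h.topPeriod_eq_integral_twistSpeed]
  refine intervalIntegral.intervalIntegral_pos_of_pos (Continuous.intervalIntegrable ?_ _ _)
    (fun x => one_div_pos.2 (h.twistSpeed_pos x)) two_pi_pos
  exact continuous_const.div h.continuous_twistSpeed fun x => (h.twistSpeed_pos x).ne'

theorem twistAngle_add_period (h : ZRegime J E l n) {ε : ℤ} {ψ : ℝ → ℝ}
    (hψ : ∀ t, HasDerivAt ψ (((n * ε : ℤ) : ℝ) * twistSpeed J E l (ψ t)) t) (t : ℝ) :
    ψ (t + topPeriod J E l) = ψ t + (n * ε : ℤ) * (2 * π) := by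
  rw [h.topPeriod_eq_integral_twistSpeed]
  exact flow_add_period h.continuous_twistSpeed h.twistSpeed_pos twistSpeed_periodic hψ rfl t

/-- `L` is a function of `ψ` alone, and `ψ` makes one turn in time `T`. Conversely, any period
brings `ψ` back modulo `2π`, hence consists of an integer number of turns and is a multiple of `T`.
-/
theorem isMinimalPeriod (h : ZRegime J E l n) (hL : IsEulerSolution J L)
    (hl : L 0 ⬝ᵥ L 0 = l ^ 2) (hE : energy J (L 0) = E) :
    IsMinimalPeriod L (topPeriod J E l) := by
  obtain ⟨ψ, hψ⟩ := h.exists_twistAngle hL hl hE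
  obtain ⟨ε, hε, hflow⟩ := h.twistAngle_flow hL hl hE hψ
  have hd := fun t => (hflow t).2.2.2
  refine ⟨⟨h.topPeriod_pos, fun t => ?_⟩, ?_⟩
  · have hadd := h.twistAngle_add_period hd t
    obtain ⟨a0, a1, a2, -⟩ := hflow t
    obtain ⟨b0, b1, b2, -⟩ := hflow (t + topPeriod J E l)
    rw [hadd, sin_add_int_mul_two_pi, (angleForm_periodic _ _).int_mul _ _, ← a0] at b0
    rw [hadd, cos_add_int_mul_two_pi, (angleForm_periodic _ _).int_mul _ _, ← a1] at b1
    rw [hadd, twistHeight_periodic.int_mul _ _, ← a2] at b2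
    ext i
    fin_cases i
    · exact b0
    · exact b1
    · exact b2
  · rintro τ ⟨hτ, hper⟩
    obtain ⟨r, hr, a0, a1⟩ := hψ.2 0
    obtain ⟨r', hr', b0, b1⟩ := hψ.2 (0 + τ)
    rw [hper 0] at b0 b1
    have hrr : r = r' := by
      have : r ^ 2 = r' ^ 2 := by
        have c1 : r ^ 2 = L 0 0 ^ 2 + L 0 1 ^ 2 := by
          rw [a0, a1]; linear_combination (-r ^ 2) * sin_sq_add_cos_sq (ψ 0)
        have c2 : r' ^ 2 = L 0 0 ^ 2 + L 0 1 ^ 2 := by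
          rw [b0, b1]; linear_combination (-r' ^ 2) * sin_sq_add_cos_sq (ψ (0 + τ))
        rw [c1, c2]
      exact (pow_left_inj₀ hr.le hr'.le two_ne_zero).1 this
    subst hrr
    have hang : (ψ (0 + τ) : Real.Angle) = ψ 0 :=
      Real.Angle.cos_sin_inj (mul_left_cancel₀ hr.ne' (b1.symm.trans a1))
        (mul_left_cancel₀ hr.ne' (b0.symm.trans a0))
    obtain ⟨k, hk⟩ := Real.Angle.angle_eq_iff_two_pi_dvd_sub.1 hang
    have htime := flow_time_eq (n := k) h.continuous_twistSpeed h.twistSpeed_pos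
      twistSpeed_periodic hd (t := 0) (τ := τ) (by linarith)
    rw [← h.topPeriod_eq_integral_twistSpeed] at htime
    have hT := h.topPeriod_pos
    have hunit : (((n * ε : ℤ) : ℝ)) * ((n * ε : ℤ) : ℝ) = 1 := by
      exact_mod_cast h.int_unit hε
    have hτ' : τ = ((n * ε * k : ℤ) : ℝ) * topPeriod J E l := by
      push_cast at htime hunit ⊢
      linear_combination (-τ) * hunit + (n * ε : ℝ) * htime
    have hpos : 0 < n * ε * k := by
      rw [hτ'] at hτ
      exact_mod_cast pos_of_mul_pos_left hτ hT.le
    have h1 : (1 : ℝ) ≤ ((n * ε * k : ℤ) : ℝ) := by exact_mod_cast hpos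
    rw [hτ']
    nlinarith

/-- The sign `ε` of `L_z` occurs twice, in the integrand and in the direction of `ψ`. It cancels, so
both orbits have the same action. -/
theorem actionIntegral_eq (h : ZRegime J E l n) (hL : IsEulerSolution J L)
    (hl : L 0 ⬝ᵥ L 0 = l ^ 2) (hE : energy J (L 0) = E) {ψ : ℝ → ℝ} (hψ : IsTwistAngle L ψ) :
    actionIntegral L ψ (topPeriod J E l) = l * solidAngle J E l / (2 * π) := by
  obtain ⟨ε, hε, hflow⟩ := h.twistAngle_flow hL hl hE hψ
  have hd := fun t => (hflow t).2.2.2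
  have hψc := hψ.1
  have hderiv : deriv ψ = fun t => ((n * ε : ℤ) : ℝ) * twistSpeed J E l (ψ t) :=
    funext fun t => (hd t).deriv
  have hsc := h.continuous_twistSpeed
  have hzc : Continuous fun t => L t 2 := (continuous_apply 2).comp hL.continuous
  have hint : Continuous fun t => L t 2 * (((n * ε : ℤ) : ℝ) * twistSpeed J E l (ψ t)) :=
    hzc.mul (continuous_const.mul (hsc.comp hψc))
  have hfc : Continuous fun x => ε * twistHeight J E l x :=
    continuous_const.mul h.continuous_twistHeight
  have hN := integral_comp_flow (f := fun x => ε * twistHeight J E l x)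
    (N := fun t => ∫ s in (0 : ℝ)..t, L s 2 * (((n * ε : ℤ) : ℝ) * twistSpeed J E l (ψ s)))
    hfc hd (fun t => intervalIntegral.integral_hasDerivAt_right (hint.intervalIntegrable _ _)
      hint.aestronglyMeasurable.stronglyMeasurableAtFilter hint.continuousAt)
    (fun t => by rw [(hflow t).2.2.1]) (0 + topPeriod J E l) 0
  have hper : Function.Periodic (fun x => ε * twistHeight J E l x) (2 * π) := fun x => by
    simp only [twistHeight_periodic x]
  rw [h.twistAngle_add_period hd, integral_add_int_mul_two_pi hfc hper] at hN
  simp only [intervalIntegral.integral_same, intervalIntegral.integral_const_mul, sub_zero,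
    zero_add] at hN
  rw [actionIntegral, hderiv, hN, h.solidAngle_eq]
  congr 1
  rw [h.sign]
  have hε' : (ε : ℝ) * ε = 1 := by exact_mod_cast hε
  push_cast
  change _ = (n : ℝ) * ∫ x in (0 : ℝ)..(2 * π), twistHeight J E l x
  linear_combination (n * ∫ x in (0 : ℝ)..(2 * π), twistHeight J E l x) * hε'

/-! ### Derivatives of the action -/

theorem eventually_energy (h : ZRegime J E l n) : ∀ᶠ E' in nhds E, ZRegime J E' l n := by
  have hc : Continuous fun E' => topD J E' l := by unfold topD; fun_prop
  filter_upwards [hc.continuousAt.eventually (lt_mem_nhds h.D_pos),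
    hc.continuousAt.eventually (gt_mem_nhds h.D_lt)] with E' h1 h2
  exact { h with D_pos := h1, D_lt := h2 }

theorem eventually_momentum (h : ZRegime J E l n) : ∀ᶠ l' in nhds l, ZRegime J E l' n := by
  have hc : Continuous fun l' => topD J E l' := by unfold topD; fun_prop
  have hc' : Continuous fun l' => topB J * l' ^ 2 - topD J E l' := by fun_prop
  filter_upwards [hc.continuousAt.eventually (lt_mem_nhds h.D_pos),
    hc'.continuousAt.eventually (lt_mem_nhds (sub_pos.2 h.D_lt)), lt_mem_nhds h.l_pos]
    with l' h1 h2 h3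
  exact { h with D_pos := h1, D_lt := sub_pos.1 h2, l_pos := h3 }

/-- The `E`-derivative of `σ z` is the reciprocal of the twist speed. The integral formula for `S`
holds only within the regime, which is open in `E`. -/
theorem hasDerivAt_action_energy (h : ZRegime J E l n) :
    HasDerivAt (fun E' => l * solidAngle J E' l / (2 * π)) (topPeriod J E l / (2 * π)) E := by
  have hd : ∀ s, HasDerivAt (fun s => topD J s l) (-2 * topSign J) s := fun s =>
    ((((hasDerivAt_id s).const_mul 2).const_sub (l ^ 2 / J 2)).const_mul
      (topSign J)).congr_deriv (by ring)
  have hmain := hasDerivAt_integral_height (a := fun _ => l ^ 2) (a' := fun _ => 0)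
    (fun s => hasDerivAt_const s _) hd continuous_const continuous_const h.B_pos h.B_lt_A
    (s₀ := E) (pow_pos h.l_pos 2) h.D_pos h.D_lt
  refine (((hmain.const_mul (topSign J)).div_const (2 * π)).congr_of_eventuallyEq ?_).congr_deriv ?_
  · filter_upwards [h.eventually_energy] with E' h'
    rw [h'.solidAngle_eq]
  · congr 1
    rw [h.topPeriod_eq, ← intervalIntegral.integral_const_mul]
    refine intervalIntegral.integral_congr fun x _ => ?_
    have h1 := (h.form_pos x).ne'
    have h2 := (sqrt_pos.2 (h.height_pos x)).ne'
    have hσ := h.sign_mul_self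
    generalize √(l ^ 2 - topD J E l / angleForm (topA J) (topB J) x) = z at h2
    field_simp
    linear_combination 2 * hσ

/-- Integrating `z = l²/z - D/(q z)` expresses `∮ z` through `∮ 1/z` and `T`; with `σ D = l²/J_z -
2E` the terms in `E` cancel. The right-hand side is the form in which the `l`-derivative and the
rotation number both appear. -/
theorem integral_twistSpeed_eq (h : ZRegime J E l n) :
    solidAngle J E l - 2 * E * topPeriod J E l / l =
      topSign J * l * (∫ x in (0 : ℝ)..(2 * π), 1 / twistHeight J E l x) -
        l / J 2 * topPeriod J E l := by
  have hl := h.l_pos.ne'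
  have h2 := (h.pos 2).ne'
  have hσ := h.sign_mul_self
  have hc1 : Continuous fun x => l ^ 2 * (1 / twistHeight J E l x) := continuous_const.mul <|
    continuous_const.div h.continuous_twistHeight fun x => (h.twistHeight_pos x).ne'
  have hc2 : Continuous fun x => topD J E l * (1 / twistSpeed J E l x) := continuous_const.mul <|
    continuous_const.div h.continuous_twistSpeed fun x => (h.twistSpeed_pos x).ne'
  have hZ : ∫ x in (0 : ℝ)..(2 * π), twistHeight J E l x =
      l ^ 2 * (∫ x in (0 : ℝ)..(2 * π), 1 / twistHeight J E l x) -
        topD J E l * topPeriod J E l := by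
    rw [h.topPeriod_eq_integral_twistSpeed, ← intervalIntegral.integral_const_mul,
      ← intervalIntegral.integral_const_mul, ← intervalIntegral.integral_sub
      (hc1.intervalIntegrable _ _) (hc2.intervalIntegrable _ _)]
    refine intervalIntegral.integral_congr fun x _ => ?_
    have h1 := (h.form_pos x).ne'
    have h3 := (h.twistHeight_pos x).ne'
    have h4 : twistHeight J E l x ^ 2 = l ^ 2 - topD J E l / angleForm (topA J) (topB J) x :=
      sq_sqrt (h.height_pos x).le
    simp only [twistSpeed]
    have h5 : l ^ 2 * (1 / twistHeight J E l x) -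
        topD J E l * (1 / (angleForm (topA J) (topB J) x * twistHeight J E l x)) =
        (l ^ 2 - topD J E l / angleForm (topA J) (topB J) x) / twistHeight J E l x := by
      field_simp
    rw [h5, ← h4]
    field_simp
  have hS : l * solidAngle J E l = topSign J * ∫ x in (0 : ℝ)..(2 * π), twistHeight J E l x :=
    h.solidAngle_eq
  have hS' : solidAngle J E l =
      topSign J * (∫ x in (0 : ℝ)..(2 * π), twistHeight J E l x) / l := by
    rw [← hS]; field_simp
  rw [hS', hZ, topD]
  field_simp
  linear_combination (-topPeriod J E l * (l ^ 2 - J 2 * 2 * E)) * hσ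

theorem hasDerivAt_action_momentum (h : ZRegime J E l n) :
    HasDerivAt (fun l' => l' * solidAngle J E l' / (2 * π))
      ((solidAngle J E l - 2 * E * topPeriod J E l / l) / (2 * π)) l := by
  have ha : ∀ s : ℝ, HasDerivAt (fun s => s ^ 2) (2 * s) s := fun s =>
    (hasDerivAt_pow 2 s).congr_deriv (by simp)
  have hd : ∀ s, HasDerivAt (fun s => topD J E s) (topSign J * (2 * s / J 2)) s := fun s =>
    (((ha s).div_const (J 2)).sub_const (2 * E)).const_mul (topSign J)
  have hmain := hasDerivAt_integral_height ha hd (by fun_prop) (by fun_prop) h.B_pos h.B_lt_A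
    (s₀ := l) (pow_pos h.l_pos 2) h.D_pos h.D_lt
  refine (((hmain.const_mul (topSign J)).div_const (2 * π)).congr_of_eventuallyEq ?_).congr_deriv ?_
  · filter_upwards [h.eventually_momentum] with l' h'
    rw [h'.solidAngle_eq]
  · congr 1
    have hc1 : Continuous fun x => topSign J * l * (1 / twistHeight J E l x) := continuous_const.mul <|
      continuous_const.div h.continuous_twistHeight fun x => (h.twistHeight_pos x).ne'
    have hc2 : Continuous fun x => l / J 2 * (1 / twistSpeed J E l x) := continuous_const.mul <|
      continuous_const.div h.continuous_twistSpeed fun x => (h.twistSpeed_pos x).ne'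
    rw [h.integral_twistSpeed_eq, h.topPeriod_eq_integral_twistSpeed,
      ← intervalIntegral.integral_const_mul, ← intervalIntegral.integral_const_mul,
      ← intervalIntegral.integral_const_mul, ← intervalIntegral.integral_sub
      (hc1.intervalIntegrable _ _) (hc2.intervalIntegrable _ _)]
    refine intervalIntegral.integral_congr fun x _ => ?_
    have h1 := (h.form_pos x).ne'
    have h2 := (h.pos 2).ne'
    have h3 := (h.twistHeight_pos x).ne'
    have hσ := h.sign_mul_self
    simp only [twistSpeed]
    change topSign J * ((2 * l - topSign J * (2 * l / J 2) / angleForm (topA J) (topB J) x) /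
      (2 * twistHeight J E l x)) = _
    field_simp
    linear_combination (-l) * hσ

/-! ### The rotation number -/

theorem somersaultAngle_add_period (h : ZRegime J E l n) {R : ℝ → Matrix (Fin 3) (Fin 3) ℝ}
    {p : Vec3} {φ : ℝ → ℝ} (hL : IsEulerSolution J L) (hl : L 0 ⬝ᵥ L 0 = l ^ 2)
    (hE : energy J (L 0) = E) (hR : IsAttitude J L R p) (hφ : IsSomersaultAngle R p φ) (t : ℝ) :
    φ (t + topPeriod J E l) - φ t = -(solidAngle J E l - 2 * E * topPeriod J E l / l) := by
  obtain ⟨ψ, hψ⟩ := h.exists_twistAngle hL hl hE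
  obtain ⟨ε, hε, hflow⟩ := h.twistAngle_flow hL hl hE hψ
  have hd := fun t => (hflow t).2.2.2
  have hε' : (ε : ℝ) * ε = 1 := by exact_mod_cast hε
  -- Here `L_x²/J_x + L_y²/J_y` is `(L_x² + L_y²)/J_z - σ (A L_x² + B L_y²)`.
  have hφd : ∀ t, HasDerivAt φ
      (l / J 2 - topSign J * l * angleForm (topA J) (topB J) (ψ t)) t := by
    intro t
    refine (hasDerivAt_somersaultAngle h.l_pos (fun t => (hL.dotProduct_self_eq t).trans hl)
      hR hφ t).congr_deriv ?_
    obtain ⟨r, hr, h0, h1⟩ := hψ.2 t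
    have e : L t 0 ^ 2 + L t 1 ^ 2 = r ^ 2 := by
      rw [h0, h1]; linear_combination r ^ 2 * sin_sq_add_cos_sq (ψ t)
    rw [e, h0, h1, angleForm, topA, topB, div_eq_iff (by positivity)]
    linear_combination (l * r ^ 2 / J 2) * sin_sq_add_cos_sq (ψ t) +
      (l * r ^ 2 * ((1 / J 2 - 1 / J 0) * sin (ψ t) ^ 2 +
        (1 / J 2 - 1 / J 1) * cos (ψ t) ^ 2)) * h.sign_mul_self
  have hc1 : Continuous fun x => 1 / twistHeight J E l x :=
    continuous_const.div h.continuous_twistHeight fun x => (h.twistHeight_pos x).ne'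
  have hc : Continuous fun x => -(ε * l) * (1 / twistHeight J E l x) := continuous_const.mul hc1
  have hper : Function.Periodic (fun x => -(ε * l) * (1 / twistHeight J E l x)) (2 * π) :=
    fun x => by simp only [twistHeight_periodic x]
  -- Without its uniform part `l t / J_z`, the angle `φ` changes at the rate `-ε l / z` per unit of
  -- `ψ`; the signs `ε` cancel again over the `n ε` turns.
  have hN := integral_comp_flow (N := fun t => φ t - l / J 2 * t) hc hd
    (fun t => (hφd t).sub ((hasDerivAt_id t).const_mul (l / J 2))) (fun t => by
      have h1 := (h.twistHeight_pos (ψ t)).ne'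
      rw [h.sign, twistSpeed]
      push_cast
      field_simp
      linear_combination (l * n * angleForm (topA J) (topB J) (ψ t)) * hε')
    (t + topPeriod J E l) t
  rw [h.twistAngle_add_period hd, integral_add_int_mul_two_pi hc hper] at hN
  simp only [intervalIntegral.integral_const_mul] at hN
  rw [h.integral_twistSpeed_eq, h.sign]
  push_cast at hN
  linear_combination hN - (n * l * ∫ x in (0 : ℝ)..(2 * π), 1 / twistHeight J E l x) * hε'

end ZRegime

theorem mainTheorem7 (J : Vec3) (E l : ℝ)
    (hJ : ∀ i, 0 < J i) (hl : 0 < l)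
    (hcase : (J 2 < J 1 ∧ J 1 < J 0 ∧ l ^ 2 / (2 * J 1) < E ∧ E < l ^ 2 / (2 * J 2)) ∨
      (J 0 < J 1 ∧ J 1 < J 2 ∧ l ^ 2 / (2 * J 2) < E ∧ E < l ^ 2 / (2 * J 1))) :
    -- the motion is periodic with least period `T`, and its action is `l S / (2π)`
    (∀ L : ℝ → Vec3, IsEulerSolution J L → L 0 ⬝ᵥ L 0 = l ^ 2 → energy J (L 0) = E →
      IsMinimalPeriod L (topPeriod J E l) ∧
      ∀ ψ : ℝ → ℝ, IsTwistAngle L ψ →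
        actionIntegral L ψ (topPeriod J E l) = l * solidAngle J E l / (2 * π)) ∧
    -- the derivative of the action with respect to the energy
    HasDerivAt (fun E' => l * solidAngle J E' l / (2 * π)) (topPeriod J E l / (2 * π)) E ∧
    -- the derivative of the action with respect to `l` is minus the rotation number `W`
    ∃ W : ℝ,
      HasDerivAt (fun l' => l' * solidAngle J E l' / (2 * π)) (-W) l ∧
      -(2 * π * W) = solidAngle J E l - 2 * E * topPeriod J E l / l ∧
      ∀ (L : ℝ → Vec3) (R : ℝ → Matrix (Fin 3) (Fin 3) ℝ) (p : Vec3) (φ : ℝ → ℝ),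
        IsEulerSolution J L → L 0 ⬝ᵥ L 0 = l ^ 2 → energy J (L 0) = E →
        IsAttitude J L R p → IsSomersaultAngle R p φ →
        ∀ t, φ (t + topPeriod J E l) - φ t = 2 * π * W := by
  obtain ⟨n, h⟩ := exists_zRegime hJ hl hcase
  refine ⟨fun L hL hLl hLE => ⟨h.isMinimalPeriod hL hLl hLE, fun ψ hψ =>
    h.actionIntegral_eq hL hLl hLE hψ⟩, h.hasDerivAt_action_energy,
    -(solidAngle J E l - 2 * E * topPeriod J E l / l) / (2 * π), ?_, ?_, ?_⟩
  · exact h.hasDerivAt_action_momentum.congr_deriv (by ring)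
  · field_simp
  · intro L R p φ hL hLl hLE hR hφ t
    rw [h.somersaultAngle_add_period hL hLl hLE hR hφ t]
    field_simp
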